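/- Let $\mathfrak g$ be a simply-laced simple Lie algebra of type $X_m\neq A_{2r}$, let $\sigma$ be a nontrivial diagram automorphism of $\mathfrak g$ of order $\kappa$, and let $\overline C$ be the Cartan matrix of the fixed-point subalgebra $\mathfrak g^\sigma$, with simple roots labelled by $I_r=\{1,\dots,r\}$ and $\overline C_{ab}=\overline\alpha_b(\overline\alpha_a^\vee)$. Thus $X_m^{(\kappa)}$ is one of $A_{2r-1}^{(2)}$, $D_{r+1}^{(2)}$ ($r\ge 2$), $E_6^{(2)}$, $D_4^{(3)}$, and $\mathfrak g^\sigma$ is of type $C_r$, $B_r$, $F_4$, $G_2$ respectively. Let $t_1^\vee,\dots,t_r^\vee$ be integers with $\min_a t_a^\vee=1$ and $t_a^\vee\overline C_{ab}=t_b^\vee\overline C_{ba}$ for all $a,b\in I_r$, and write $\mathbb N=\{1,2,\dots\}$. Let $\overline\lambda=\sum_{a}\ell_a\overline\omega_a$ ($\ell_a\in\mathbb Z_{\ge0}$) be a dominant $\mathfrak g^\sigma$-weight, where $\overline\omega_a$ are the fundamental weights, and let $\mathbf n=(n_{a,i})_{a\in I_r,i\in\mathbb N}$ be a vector of nonnegative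 integers with finitely many nonzero entries ($n_{a,i}$ counts Kirillov--Reshetikhin modules of type $(a,i)$). For a vector $\mathbf m=(m_{a,i})_{a\in I_r,i\in\mathbb N}$ of nonnegative integers with finitely many nonzero entries put $$q_{a,0}=\ell_a+\sum_{j\in\mathbb N}\sum_{b\in I_r}j(\overline C_{ab}m_{b,j}-\delta_{ab}n_{b,j}),\qquad p_{a,i}=\sum_{j\in\mathbb N}\sum_{b\in I_r}\min(i,j)(\delta_{ab}n_{b,j}-\overline C_{ab}m_{b,j}),$$ $$Q(\mathbf m,\mathbf n)=\frac12\sum_{i,j\in\mathbb N}\sum_{a,b\in I_r}t_a^\vee\min(i,j)\,m_{a,i}(\overline C_{ab}m_{b,j}-2\delta_{ab}n_{b,j})\in\mathbb Z .$$ For $m\in\mathbb Z_{\ge0}$ and $p\in\mathbb Z$ let $\begin{bmatrix}m+p\\m\end{bmatrix}_v=\prod_{j=1}^m\frac{1-v^{p+j}}{1-v^j}$, and let $q_a=q^{t_a^\vee}$ with $q$ an indeterminate. Define, in $\mathbb Q(q)$, $$M_{\overline\lambda,\mathbf n}(q^{-1})=\sum_{\substack{\mathbf m\ge\mathbf 0\\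 q_{a,0}=0\ \forall a,\ p_{a,i}\ge0\ \forall a,i}}q^{Q(\mathbf m,\mathbf n)}\prod_{i\in\mathbb N}\prod_{a\in I_r}\begin{bmatrix}m_{a,i}+p_{a,i}\\m_{a,i}\end{bmatrix}_{q_a},$$ and let $\tilde M_{\overline\lambda,\mathbf n}(q^{-1})$ be the same sum without the constraints $p_{a,i}\ge0$. Then there are only finitely many $\mathbf m\ge\mathbf 0$ with $q_{a,0}=0$ for all $a\in I_r$ (so both sums are finite), and $$M_{\overline\lambda,\mathbf n}(q^{-1})=\tilde M_{\overline\lambda,\mathbf n}(q^{-1}).$$ -/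

import Mathlib

/-- The twisted affine types `X_m^{(κ)}` other than `A_{2r}^{(2)}`: a simply-laced simple Lie
algebra `𝔤` of type `X_m ≠ A_{2r}` with a nontrivial diagram automorphism `σ` of order `κ`. -/
inductive TwistedType : Type
  /-- `A_{2r-1}^{(2)}`, `r ≥ 2` -/
  | A2 (r : ℕ) (hr : 2 ≤ r)
  /-- `D_{r+1}^{(2)}`, `r ≥ 2` (with `D_3 = A_3`) -/
  | D2 (r : ℕ) (hr : 2 ≤ r)
  /-- `E_6^{(2)}` -/
  | E62
  /-- `D_4^{(3)}` -/
  | D43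

/-- The rank of the fixed-point subalgebra `𝔤^σ`. -/
abbrev TwistedType.rank : TwistedType → ℕ
  | .A2 r _ => r
  | .D2 r _ => r
  | .E62 => 4
  | .D43 => 2

/-- The Cartan matrix `C a b = α_b (α_a^∨)` of `𝔤^σ`, which has type `C_r`, `B_r`, `F_4`, `G_2`
for `A_{2r-1}^{(2)}`, `D_{r+1}^{(2)}`, `E_6^{(2)}`, `D_4^{(3)}` respectively. Mathlib's classical
matrices `CartanMatrix.B` and `CartanMatrix.C` use the transposed convention `α_a (α_b^∨)`
(with `α_r` the exceptional root), hence the transposes. For `F_4` and `G_2` Mathlib's matrices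
are those of the convention used here, with the short simple roots listed first. -/
def TwistedType.cartan : (X : TwistedType) → Matrix (Fin X.rank) (Fin X.rank) ℤ
  | .A2 r _ => (CartanMatrix.C r).transpose
  | .D2 r _ => (CartanMatrix.B r).transpose
  | .E62 => CartanMatrix.F₄
  | .D43 => CartanMatrix.G₂

namespace Fermionic

variable {ι : Type} [DecidableEq ι]

/-- The total spin `q_{a,0} = ℓ_a + ∑_{j ≥ 1} ∑_b j (C_{ab} m_{b,j} - δ_{ab} n_{b,j})`. -/
def totalSpin (C : Matrix ι ι ℤ) (ℓ : ι → ℕ) (n m : ι × ℕ+ →₀ ℕ) (a : ι) : ℤ :=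
  (ℓ a : ℤ) + (m.sum fun x k => ((x.2 : ℕ) : ℤ) * C a x.1 * (k : ℤ))
    - n.sum fun x k => if x.1 = a then ((x.2 : ℕ) : ℤ) * (k : ℤ) else 0

/-- The vacancy number
`p_{a,i} = ∑_{j ≥ 1} ∑_b min(i,j) (δ_{ab} n_{b,j} - C_{ab} m_{b,j})`. -/
def vacancy (C : Matrix ι ι ℤ) (n m : ι × ℕ+ →₀ ℕ) (a : ι) (i : ℕ+) : ℤ :=
  (n.sum fun x k => if x.1 = a then ((min i x.2 : ℕ+) : ℕ) * (k : ℤ) else 0)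
    - m.sum fun x k => ((min i x.2 : ℕ+) : ℕ) * C a x.1 * (k : ℤ)

/-- The quadratic part `∑_{i,j} ∑_{a,b} t_a min(i,j) m_{a,i} C_{ab} m_{b,j}`. -/
def quadPart (C : Matrix ι ι ℤ) (t : ι → ℤ) (m : ι × ℕ+ →₀ ℕ) : ℤ :=
  m.sum fun x k => m.sum fun y l =>
    t x.1 * ((min x.2 y.2 : ℕ+) : ℕ) * (k : ℤ) * (C x.1 y.1 * (l : ℤ))

/-- The linear part `∑_{i,j} ∑_{a,b} t_a min(i,j) m_{a,i} δ_{ab} n_{b,j}`. -/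
def linPart (t : ι → ℤ) (n m : ι × ℕ+ →₀ ℕ) : ℤ :=
  m.sum fun x k => n.sum fun y l =>
    if x.1 = y.1 then t x.1 * ((min x.2 y.2 : ℕ+) : ℕ) * (k : ℤ) * (l : ℤ) else 0

/-- `Q(m,n) = 1/2 ∑_{i,j} ∑_{a,b} t_a min(i,j) m_{a,i} (C_{ab} m_{b,j} - 2 δ_{ab} n_{b,j})`.
It is an integer, the division by `2` being exact: see `two_mul_quadForm`. -/
def quadForm (C : Matrix ι ι ℤ) (t : ι → ℤ) (n m : ι × ℕ+ →₀ ℕ) : ℤ :=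
  (quadPart C t m - 2 * linPart t n m) / 2

theorem even_sum_sum {α : Type} [DecidableEq α] (s : Finset α) (f : α → α → ℤ)
    (hs : ∀ x y, f x y = f y x) (hd : ∀ x, Even (f x x)) :
    Even (∑ x ∈ s, ∑ y ∈ s, f x y) := by
  induction s using Finset.induction_on with
  | empty => simp
  | insert a s ha ih =>
    have h : ∑ x ∈ insert a s, ∑ y ∈ insert a s, f x y
        = f a a + 2 * (∑ y ∈ s, f a y) + ∑ x ∈ s, ∑ y ∈ s, f x y := by
      rw [Finset.sum_insert ha, Finset.sum_insert ha]
      simp only [Finset.sum_insert ha, Finset.sum_add_distrib]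
      rw [Finset.sum_congr rfl fun x _ => hs x a]
      ring
    rw [h]
    exact ((hd a).add (even_two_mul _)).add ih

theorem two_mul_quadForm (C : Matrix ι ι ℤ) (t : ι → ℤ)
    (hC : ∀ a, C a a = 2) (ht : ∀ a b, t a * C a b = t b * C b a) (n m : ι × ℕ+ →₀ ℕ) :
    2 * quadForm C t n m = quadPart C t m - 2 * linPart t n m := by
  have h : Even (quadPart C t m) := by
    unfold quadPart Finsupp.sum
    apply even_sum_sum
    · intro x y
      beta_reduce
      have h1 := ht x.1 y.1
      rw [min_comm y.2 x.2]
      linear_combination ((min x.2 y.2 : ℕ+) : ℕ) * (m x : ℤ) * (m y : ℤ) * h1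
    · intro x
      beta_reduce
      rw [hC]
      exact ⟨t x.1 * ((min x.2 x.2 : ℕ+) : ℕ) * (m x : ℤ) * (m x : ℤ), by ring⟩
  unfold quadForm
  exact Int.mul_ediv_cancel' (dvd_sub h.two_dvd (dvd_mul_right _ _))

/-- The Gaussian binomial `[m+p; m]_v` for `p ∈ ℤ` and `m ≥ 0`. The quotient
`(v^{p+1};v)_∞ (v^{m+1};v)_∞ / ((v;v)_∞ (v^{p+m+1};v)_∞)` of infinite products is, after
cancelling common factors, the finite product `∏_{j=1}^m (1 - v^{p+j}) / (1 - v^j)`. -/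
noncomputable def gaussBinom (v : RatFunc ℚ) (p : ℤ) (m : ℕ) : RatFunc ℚ :=
  ∏ j ∈ Finset.Icc 1 m, (1 - v ^ (p + (j : ℤ))) / (1 - v ^ j)

/-- The summand `q^{Q(m,n)} ∏_{i ≥ 1} ∏_a [m_{a,i} + p_{a,i}; m_{a,i}]_{q_a}`, `q_a = q^{t_a}`, in
the field `ℚ(q)`. Factors with `m_{a,i} = 0` equal `1`, so the product runs over the support
of `m`. -/
noncomputable def summand (C : Matrix ι ι ℤ) (t : ι → ℤ) (n m : ι × ℕ+ →₀ ℕ) : RatFunc ℚ :=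
  RatFunc.X ^ quadForm C t n m *
    m.prod fun x k => gaussBinom (RatFunc.X ^ t x.1) (vacancy C n m x.1 x.2) k

/-- The vectors `m ≥ 0` with `q_{a,0} = 0` for all `a`. -/
def admissible (C : Matrix ι ι ℤ) (ℓ : ι → ℕ) (n : ι × ℕ+ →₀ ℕ) : Set (ι × ℕ+ →₀ ℕ) :=
  {m | ∀ a, totalSpin C ℓ n m a = 0}

/-- The restricted sum `M_{λ,n}(q⁻¹)`: all `q_{a,0} = 0` and all `p_{a,i} ≥ 0`. -/
noncomputable def MSum (C : Matrix ι ι ℤ) (t : ι → ℤ) (ℓ : ι → ℕ) (n : ι × ℕ+ →₀ ℕ) :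
    RatFunc ℚ :=
  ∑ᶠ m ∈ {m ∈ admissible C ℓ n | ∀ (a : ι) (i : ℕ+), 0 ≤ vacancy C n m a i}, summand C t n m

/-- The unrestricted sum `M̃_{λ,n}(q⁻¹)`: all `q_{a,0} = 0`, no condition on the `p_{a,i}`. -/
noncomputable def MTildeSum (C : Matrix ι ι ℤ) (t : ι → ℤ) (ℓ : ι → ℕ) (n : ι × ℕ+ →₀ ℕ) :
    RatFunc ℚ :=
  ∑ᶠ m ∈ admissible C ℓ n, summand C t n m

end Fermionic

/-!
The difference of the two sums consists of the summands with some `p_{a,i} < 0`, and these cancel in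
groups, by a reduction to rank one.

*The groups.* Since `q_{a,0} = 0`, the vacancy number `p_{a,i}` depends only on the multiplicities at
levels above `i`, and `p_{a,i} = ℓ_a ≥ 0` for large `i`. Given `m` with a negative vacancy number, let
`k` be the largest level at which one occurs, let `p_{a,k} < 0`, and freeze all the multiplicities
except `x_i = m_{a,i}`, `i ≤ k`. Inside this group `k` and `a` do not change, and the conditions
`q_{b,0} = 0` amount to fixing `∑_i i x_i`.

*Reduction to rank one.* Put `v = q_a`. As functions of `x`, the frozen factors
`[m_{b,j} + p_{b,j}; m_{b,j}]` with `b ≠ a`, `j ≤ k` are polynomials of degree at most `m_{b,j}` in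
`q_b ^ p_{b,j}`, hence (because `t_a C_{ab} = t_b C_{ba}`) combinations of powers
`v ^ (∑ min(i,j) x_i κ_j)` with `0 ≤ κ_j ≤ - ∑_{b ≠ a} C_{ab} m_{b,j}` (`gaussBinom_mem_expSpan`). The
group thus contributes a combination of rank one sums (`rankOneSum`)
`∑_x v ^ (∑ min(i,j) x_i (x_j - c_j)) ∏_i [x_i + p_i; x_i]_v`, where
`p_i = ∑_j min(i,j) (a_j + c_j - 2 x_j)` and `2 ∑_i i x_i = 1 + ∑_i i (a_i + c_i)`, for vectors
`(a_j), (c_j) ≥ 0` (not to be confused with the colour `a`). Their nonnegativity comes from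
the range of `κ` and from `p_{a,k} < 0 ≤ p_{a,k+1}`.

*Rank one.* By the two `q`-Pascal rules the rank one sum, extended to integer vectors `(a_j)` and
`(c_j)`, satisfies in `(c_j)`, and with `v⁻¹` in place of `v` also in `(a_j)`, the relations
`Q_j² = Q_{j+1} Q_{j-1} + (power of v)`, `Q_0 = 1`, of the quantum `Q`-system of type `A_1`
(`IsQFunctional`). These imply a linear recursion `Q_{j+1} = Q_j Q_1 - Q_{j-1}` with a correction
term (`IsQFunctional.linear_recursion`), which reduces all nonnegative exponents to exponents
concentrated at level `1`. There every summand vanishes (`rankOneSum_eq_zero`), since the vacancy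
number at the largest occurring level is `-1`.

Finiteness holds because the Cartan matrix is nonsingular, so that `q_{a,0} = 0` for all `a` fixes
the weights `∑_j j m_{b,j}`.
-/

namespace Fermionic

/-! ### Functionals satisfying the quantum `Q`-system of type `A_1` -/

/-- `∑_j min(i,j) y_j`, as a linear functional of the finitely supported vector `y`. Level `0` is
allowed as an index and contributes nothing. -/
noncomputable def minSum (i : ℕ) : (ℕ →₀ ℤ) →ₗ[ℤ] ℤ :=
  Finsupp.linearCombination ℤ fun j => ((min i j : ℕ) : ℤ)

@[simp]
theorem minSum_single (i j : ℕ) (k : ℤ) :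
    minSum i (Finsupp.single j k) = k * ((min i j : ℕ) : ℤ) := by
  simp [minSum]

@[simp]
theorem minSum_zero_left (y : ℕ →₀ ℤ) : minSum 0 y = 0 := by
  simp [minSum, Finsupp.linearCombination_apply]

/-- The total mass `∑_j y_j`. -/
noncomputable def mass : (ℕ →₀ ℤ) →ₗ[ℤ] ℤ :=
  Finsupp.linearCombination ℤ fun _ => (1 : ℤ)

@[simp]
theorem mass_single (j : ℕ) (k : ℤ) : mass (Finsupp.single j k) = k := by
  simp [mass]

theorem minSum_eq_of_le {i : ℕ} {y : ℕ →₀ ℤ} (h : ∀ j < i, y j = 0) :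
    minSum i y = i * mass y := by
  unfold minSum mass
  rw [Finsupp.linearCombination_apply, Finsupp.linearCombination_apply, Finsupp.sum, Finsupp.sum,
    Finset.mul_sum]
  refine Finset.sum_congr rfl fun j hj => ?_
  have hij : i ≤ j := by
    by_contra hlt
    exact (Finsupp.mem_support_iff.mp hj) (h j (not_le.mp hlt))
  simp [min_eq_left hij, mul_comm]

section Elimination

variable {K : Type*} [Field K]

/-- A function `f` on exponent vectors is a *Q-functional* if it is annihilated by the quadratic
relations `Q_j² = Q_{j+1} Q_{j-1} + (power of v)`, `Q_0 = 1`, of the quantum `Q`-system of type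
`A_1`, in normal-ordered form; `f c` plays the role of the value on `∏_j Q_j^{c_j}`, and negative
exponents are allowed. -/
structure IsQFunctional (v : K) (f : (ℕ →₀ ℤ) → K) : Prop where
  add_zero_level : ∀ c, f (c + Finsupp.single 0 1) = f c
  quadratic : ∀ (j : ℕ) (c : ℕ →₀ ℤ),
    f (c + Finsupp.single (j + 1) 2) =
      v ^ (-((j : ℤ) + 1) - minSum (j + 1) c) * f c +
        f (c + Finsupp.single (j + 2) 1 + Finsupp.single j 1)

theorem IsQFunctional.quadratic_of_eq {v : K} {f : (ℕ →₀ ℤ) → K} (hf : IsQFunctional v f)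
    (j : ℕ) (c : ℕ →₀ ℤ) {x z : ℕ →₀ ℤ} {e : ℤ} (hx : c + Finsupp.single (j + 1) 2 = x)
    (hz : c + Finsupp.single (j + 2) 1 + Finsupp.single j 1 = z)
    (he : -((j : ℤ) + 1) - minSum (j + 1) c = e) :
    f x = v ^ e * f c + f z := by
  subst hx hz he
  exact hf.quadratic j c

/-- The linear recursion `Q_{j+1} = Q_j Q_1 - Q_{j-1}`, with the correction caused by moving it past
`Q_1 ^ k`. It follows from the quadratic relations by induction on `j`: the terms carrying the
inverse `Q_{j-1}⁻¹` cancel. -/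
theorem IsQFunctional.linear_recursion {v : K} (hv : v ≠ 0) {f : (ℕ →₀ ℤ) → K}
    (hf : IsQFunctional v f) (j : ℕ) (k : ℤ) (b : ℕ →₀ ℤ) (hb : ∀ i < j + 2, b i = 0) :
    f (Finsupp.single 1 k + b + Finsupp.single (j + 3) 1) =
      f (Finsupp.single 1 (k + 1) + b + Finsupp.single (j + 2) 1)
        - v ^ (-1 - mass b) * f (Finsupp.single 1 k + b + Finsupp.single (j + 1) 1)
        + v ^ (-1 - mass b) * (1 - v ^ (-k)) *
          f (Finsupp.single 1 (k - 1) + b + Finsupp.single (j + 2) 1) := by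
  induction j generalizing b with
  | zero =>
    have h1 : minSum 1 b = mass b := by
      rw [minSum_eq_of_le fun i hi => hb i (by omega)]; simp
    have h2 : minSum 2 b = 2 * mass b := by
      rw [minSum_eq_of_le fun i hi => hb i (by omega)]; simp
    have e1 := hf.quadratic_of_eq 1 (Finsupp.single 1 (k - 1) + b)
      (x := Finsupp.single 1 (k - 1) + b + Finsupp.single 2 2)
      (z := Finsupp.single 1 k + b + Finsupp.single 3 1) (e := -1 - k - 2 * mass b) rfl
      (by ext i; simp only [Finsupp.add_apply, Finsupp.single_apply]; split_ifs <;> ring)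
      (by simp [h2]; ring)
    have e2 := hf.quadratic_of_eq 0 (Finsupp.single 1 (k - 1) + b + Finsupp.single 2 1)
      (x := Finsupp.single 1 (k + 1) + b + Finsupp.single 2 1)
      (z := Finsupp.single 1 (k - 1) + b + Finsupp.single 2 2 + Finsupp.single 0 1)
      (e := -1 - k - mass b)
      (by ext i; simp only [Finsupp.add_apply, Finsupp.single_apply]; split_ifs <;> ring)
      (by ext i; simp only [Finsupp.add_apply, Finsupp.single_apply]; split_ifs <;> ring)
      (by simp [h1]; ring)
    have e3 := hf.quadratic_of_eq 0 (Finsupp.single 1 (k - 1) + b)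
      (x := Finsupp.single 1 k + b + Finsupp.single 1 1)
      (z := Finsupp.single 1 (k - 1) + b + Finsupp.single 2 1 + Finsupp.single 0 1)
      (e := -k - mass b)
      (by ext i; simp only [Finsupp.add_apply, Finsupp.single_apply]; split_ifs <;> ring)
      rfl (by simp [h1]; ring)
    rw [hf.add_zero_level] at e2 e3
    have p1 : v ^ (-1 - mass b) * v ^ (-k - mass b) = v ^ (-1 - k - 2 * mass b) := by
      rw [← zpow_add₀ hv]; congr 1; ring
    have p2 : v ^ (-1 - mass b) * v ^ (-k) = v ^ (-1 - k - mass b) := by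
      rw [← zpow_add₀ hv]; congr 1; ring
    simp only [Nat.reduceAdd]
    linear_combination (-1 : K) * e1 - e2 + v ^ (-1 - mass b) * e3
      + f (Finsupp.single 1 (k - 1) + b) * p1
      + f (Finsupp.single 1 (k - 1) + b + Finsupp.single 2 1) * p2
  | succ j ih =>
    have h1 : minSum (j + 3) b = (j + 3) * mass b := by
      rw [minSum_eq_of_le fun i hi => hb i (by omega)]; simp
    have h2 : minSum (j + 2) b = (j + 2) * mass b := by
      rw [minSum_eq_of_le fun i hi => hb i (by omega)]; simp
    have m1 : min (j + 3) 1 = 1 := by omega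
    have m2 : min (j + 3) (j + 2) = j + 2 := by omega
    have m3 : min (j + 2) 1 = 1 := by omega
    have e0 := ih (b + Finsupp.single (j + 3) 1 - Finsupp.single (j + 2) 1) fun i hi => by
      simp [hb i (by omega), show j + 3 ≠ i by omega, show j + 2 ≠ i by omega]
    have e1 := hf.quadratic_of_eq (j + 2) (Finsupp.single 1 k + b - Finsupp.single (j + 2) 1)
      (x := Finsupp.single 1 k + (b + Finsupp.single (j + 3) 1 - Finsupp.single (j + 2) 1)
        + Finsupp.single (j + 3) 1)
      (z := Finsupp.single 1 k + b + Finsupp.single (j + 4) 1)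
      (e := -1 - k - (j + 3) * mass b)
      (by ext i; simp only [Finsupp.add_apply, Finsupp.sub_apply, Finsupp.single_apply]
          split_ifs <;> ring)
      (by ext i; simp only [Finsupp.add_apply, Finsupp.sub_apply, Finsupp.single_apply]
          split_ifs <;> ring)
      (by simp only [map_add, map_sub, minSum_single, h1, m1, m2]; push_cast; ring)
    have e2 := hf.quadratic_of_eq (j + 1) (Finsupp.single 1 k + b - Finsupp.single (j + 2) 1)
      (x := Finsupp.single 1 k + b + Finsupp.single (j + 2) 1)
      (z := Finsupp.single 1 k + (b + Finsupp.single (j + 3) 1 - Finsupp.single (j + 2) 1)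
        + Finsupp.single (j + 1) 1)
      (e := - k - (j + 2) * mass b)
      (by ext i; simp only [Finsupp.add_apply, Finsupp.sub_apply, Finsupp.single_apply]
          split_ifs <;> ring)
      (by ext i; simp only [Finsupp.add_apply, Finsupp.sub_apply, Finsupp.single_apply]
          split_ifs <;> ring)
      (by simp only [map_add, map_sub, minSum_single, h2, m3, min_self]; push_cast; ring)
    have p : v ^ (-1 - mass b) * v ^ (-k - (j + 2) * mass b)
        = v ^ (-1 - k - (j + 3) * mass b) := by
      rw [← zpow_add₀ hv]; congr 1; ring
    have r (l : ℤ) : Finsupp.single 1 l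
          + (b + Finsupp.single (j + 3) 1 - Finsupp.single (j + 2) 1) + Finsupp.single (j + 2) 1
        = Finsupp.single 1 l + b + Finsupp.single (j + 3) 1 := by abel
    have hm : mass (b + Finsupp.single (j + 3) 1 - Finsupp.single (j + 2) 1) = mass b := by simp
    rw [r, r, hm] at e0
    simp only [add_assoc, Nat.reduceAdd] at e0 e1 e2 ⊢
    linear_combination e0 - e1 + v ^ (-1 - mass b) * e2
      + f (Finsupp.single 1 k + b - Finsupp.single (j + 2) 1) * p

/-- A Q-functional that vanishes on the powers of `Q_1` vanishes on all monomials
`∏_{j ≥ 1} Q_j^{c_j}` with nonnegative exponents: every such monomial is a combination of powers of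
`Q_1`. -/
theorem IsQFunctional.eq_zero {v : K} (hv : v ≠ 0) {f : (ℕ →₀ ℤ) → K} (hf : IsQFunctional v f)
    (h1 : ∀ k : ℤ, 0 ≤ k → f (Finsupp.single 1 k) = 0) {c : ℕ →₀ ℤ} (hc : 0 ≤ c)
    (hc0 : c 0 = 0) : f c = 0 := by
  -- The sum of `i² c_i` drops in every reduction step.
  let w : (ℕ →₀ ℤ) →ₗ[ℤ] ℤ := Finsupp.linearCombination ℤ fun i => (i : ℤ) ^ 2
  have hws (i : ℕ) (k : ℤ) : w (Finsupp.single i k) = k * (i : ℤ) ^ 2 := by simp [w]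
  have hw (c : ℕ →₀ ℤ) (hc : 0 ≤ c) : 0 ≤ w c :=
    Finset.sum_nonneg fun i _ => mul_nonneg (hc i) (by positivity)
  obtain ⟨N, hN⟩ : ∃ N : ℕ, w c < N := ⟨(w c).toNat + 1, by have := hw c hc; omega⟩
  induction N generalizing c with
  | zero => exact absurd (hw c hc) (by push_cast at hN; omega)
  | succ N ih =>
    push_cast at hN
    by_cases hex : ∃ i, 2 ≤ i ∧ 0 < c i
    · have hi := Nat.find_spec hex
      have hmin := fun i (hi : i < Nat.find hex) => Nat.find_min hex hi
      obtain ⟨i, hi_eq⟩ : ∃ i, Nat.find hex = i + 2 := ⟨Nat.find hex - 2, by omega⟩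
      rw [hi_eq] at hi hmin
      have hb0 : ∀ x < i + 2, x ≠ 1 → c x = 0 := by
        intro x hx hx1
        rcases Nat.eq_zero_or_pos x with rfl | hpos
        · exact hc0
        · have := hmin x hx
          have := hc x
          simp only [Finsupp.coe_zero, Pi.zero_apply] at this
          by_contra hne
          exact hmin x hx ⟨by omega, by omega⟩
      have hcpos (x : ℕ) : 0 ≤ c x := hc x
      rcases i with _ | i
      · have e := hf.quadratic_of_eq 0 (c - Finsupp.single 2 1)
          (x := c - Finsupp.single 2 1 + Finsupp.single 1 2) (z := c + Finsupp.single 0 1) rfl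
          (by abel) rfl
        rw [hf.add_zero_level] at e
        have hnn : 0 ≤ c - Finsupp.single 2 1 := by
          intro x
          have := hcpos x
          simp only [Finsupp.coe_zero, Pi.zero_apply, Finsupp.sub_apply, Finsupp.single_apply]
          split_ifs with h
          · subst h; have := hi.2; simp only [Nat.zero_add] at this; omega
          · omega
        rw [ih (c := c - Finsupp.single 2 1) hnn (by simp [hc0])
            (by simp only [map_sub, hws]; push_cast; omega),
          ih (c := c - Finsupp.single 2 1 + Finsupp.single 1 2)
            (add_nonneg hnn (by simp)) (by simp [hc0])
            (by simp only [map_sub, map_add, hws]; push_cast; omega)] at e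
        simpa using e.symm
      · set b := c - Finsupp.single 1 (c 1) - Finsupp.single (i + 3) 1 with hb
        have hcb : c = Finsupp.single 1 (c 1) + b + Finsupp.single (i + 3) 1 := by rw [hb]; abel
        have hbx (x : ℕ) : b x = c x - (if x = 1 then c 1 else 0)
            - (if x = i + 3 then 1 else 0) := by
          simp only [hb, Finsupp.sub_apply, Finsupp.single_apply, eq_comm]
        have hbz : ∀ x < i + 3, b x = 0 := by
          intro x hx
          rw [hbx, if_neg hx.ne]
          by_cases h : x = 1
          · simp [h]
          · simp [h, hb0 x hx h]
        have hbn : 0 ≤ b := by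
          intro x
          simp only [Finsupp.coe_zero, Pi.zero_apply]
          rcases lt_or_ge x (i + 3) with h | h
          · rw [hbz x h]
          · rw [hbx, if_neg (by omega)]
            rcases h.eq_or_lt with rfl | h'
            · have : 0 < c (i + 3) := hi.2
              rw [if_pos rfl]
              omega
            · rw [if_neg h'.ne']
              have := hcpos x
              omega
        have hwc := congrArg w hcb
        simp only [map_add, hws] at hwc
        push_cast at hwc
        rw [hwc] at hN
        have key (k : ℤ) (hk : 0 ≤ k) (l : ℕ) (hl : l < i + 2)
            (hlt : k + (l + 1) ^ 2 < c 1 + ((i : ℤ) + 3) ^ 2) :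
            f (Finsupp.single 1 k + b + Finsupp.single (l + 1) 1) = 0 := by
          refine ih (add_nonneg (add_nonneg (by simpa using hk) hbn) (by simp)) ?_ ?_
          · simp [hbz 0 (by omega)]
          · simp only [map_add, hws]
            push_cast
            linarith
        rw [hcb, hf.linear_recursion hv i (c 1) b fun x hx => hbz x (by omega),
          key _ (by have := hcpos 1; omega) (i + 1) (by omega) (by push_cast; nlinarith),
          key _ (hcpos 1) i (by omega) (by nlinarith)]
        rcases (hcpos 1).eq_or_lt with h0 | hpos
        · simp [← h0]
        · rw [key _ (by omega) (i + 1) (by omega) (by push_cast; nlinarith)]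
          simp
    · have : c = Finsupp.single 1 (c 1) := by
        ext x
        rcases eq_or_ne x 1 with rfl | hx
        · simp
        · rw [Finsupp.single_apply, if_neg hx.symm]
          rcases Nat.eq_zero_or_pos x with rfl | hpos
          · exact hc0
          · have := hc x
            simp only [Finsupp.coe_zero, Pi.zero_apply] at this
            by_contra hne
            exact hex ⟨x, by omega, by omega⟩
      rw [this]
      exact h1 _ (hc 1)

end Elimination

/-! ### Gaussian binomials and rank one fermionic sums -/

theorem gaussBinom_zero (v : RatFunc ℚ) (p : ℤ) : gaussBinom v p 0 = 1 := by
  simp [gaussBinom]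

theorem gaussBinom_succ (v : RatFunc ℚ) (p : ℤ) (m : ℕ) :
    gaussBinom v p (m + 1) =
      gaussBinom v p m * ((1 - v ^ (p + (m + 1 : ℕ))) / (1 - v ^ (m + 1))) := by
  rw [gaussBinom, Finset.prod_Icc_succ_top (by omega), gaussBinom]

theorem gaussBinom_neg_one (v : RatFunc ℚ) {m : ℕ} (hm : m ≠ 0) : gaussBinom v (-1) m = 0 := by
  refine Finset.prod_eq_zero (i := 1) (by simp; omega) ?_
  simp

theorem gaussBinom_sub_one_succ {v : RatFunc ℚ} (hv1 : ∀ j : ℕ, v ^ (j + 1) ≠ 1)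
    (p : ℤ) (m : ℕ) :
    gaussBinom v (p - 1) (m + 1) = (1 - v ^ p) / (1 - v ^ (m + 1)) * gaussBinom v p m := by
  induction m with
  | zero => simp [gaussBinom]
  | succ m ih =>
    have h1 := sub_ne_zero.mpr (hv1 m).symm
    have h2 := sub_ne_zero.mpr (hv1 (m + 1)).symm
    rw [gaussBinom_succ, ih, gaussBinom_succ v p m,
      show p - 1 + ((m + 1 + 1 : ℕ) : ℤ) = p + ((m + 1 : ℕ) : ℤ) by push_cast; ring]
    field_simp

/-- First `q`-Pascal rule, valid for all `p ∈ ℤ`. -/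
theorem gaussBinom_pascal {v : RatFunc ℚ} (hv : v ≠ 0) (hv1 : ∀ j : ℕ, v ^ (j + 1) ≠ 1)
    (p : ℤ) (m : ℕ) :
    gaussBinom v p (m + 1) =
      gaussBinom v p m + v ^ (m + 1) * gaussBinom v (p - 1) (m + 1) := by
  have h1 := sub_ne_zero.mpr (hv1 m).symm
  rw [gaussBinom_sub_one_succ hv1, gaussBinom_succ, zpow_add₀ hv, zpow_natCast]
  field_simp
  ring

/-- Second `q`-Pascal rule, valid for all `p ∈ ℤ`. -/
theorem gaussBinom_pascal' {v : RatFunc ℚ} (hv : v ≠ 0) (hv1 : ∀ j : ℕ, v ^ (j + 1) ≠ 1)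
    (p : ℤ) (m : ℕ) :
    gaussBinom v p (m + 1) =
      v ^ p * gaussBinom v p m + gaussBinom v (p - 1) (m + 1) := by
  have h1 := sub_ne_zero.mpr (hv1 m).symm
  rw [gaussBinom_sub_one_succ hv1, gaussBinom_succ, zpow_add₀ hv, zpow_natCast]
  field_simp
  ring

/-- The bilinear form `∑_{i,j} min(i,j) x_i y_j`. -/
noncomputable def minForm : (ℕ →₀ ℤ) →ₗ[ℤ] (ℕ →₀ ℤ) →ₗ[ℤ] ℤ :=
  Finsupp.linearCombination ℤ minSum

@[simp]
theorem minForm_single_left (i : ℕ) (k : ℤ) (y : ℕ →₀ ℤ) :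
    minForm (Finsupp.single i k) y = k * minSum i y := by
  simp [minForm]

@[simp]
theorem minForm_single_right (x : ℕ →₀ ℤ) (j : ℕ) (k : ℤ) :
    minForm x (Finsupp.single j k) = k * minSum j x := by
  induction x using Finsupp.induction_linear with
  | zero => simp
  | add x y hx hy => simp only [map_add, LinearMap.add_apply, hx, hy]; ring
  | single i l => simp [min_comm]; ring

/-- The weight `∑_j j y_j`. -/
noncomputable def wt : (ℕ →₀ ℤ) →ₗ[ℤ] ℤ := Finsupp.linearCombination ℤ fun j => (j : ℤ)

@[simp]
theorem wt_single (j : ℕ) (k : ℤ) : wt (Finsupp.single j k) = k * j := by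
  simp [wt]

/-- A vector of multiplicities on the levels `1, 2, …`, as an integer vector on `ℕ`. -/
noncomputable def levels : (ℕ+ →₀ ℕ) →+ (ℕ →₀ ℤ) :=
  Finsupp.liftAddHom fun j => (Finsupp.singleAddHom (j : ℕ)).comp (Nat.castAddMonoidHom ℤ)

@[simp]
theorem levels_single (j : ℕ+) (k : ℕ) :
    levels (Finsupp.single j k) = Finsupp.single (j : ℕ) (k : ℤ) := by
  simp [levels]

theorem levels_apply (m : ℕ+ →₀ ℕ) (j : ℕ+) : levels m j = m j := by
  induction m using Finsupp.induction_linear with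
  | zero => simp
  | add x y hx hy => simp [hx, hy]
  | single i l => simp [Finsupp.single_apply]

/-- Only finitely many multiplicity vectors have bounded weight, if only finitely many `x` do. -/
theorem finite_sum_mul_le {α : Type*} (w : α → ℕ) (hw : ∀ x, 0 < w x)
    (hfin : ∀ N, {x | w x ≤ N}.Finite) (N : ℕ) :
    {m : α →₀ ℕ | (m.sum fun x k => w x * k) ≤ N}.Finite := by
  classical
  refine (Set.finite_Iic (∑ x ∈ (hfin N).toFinset, Finsupp.single x N)).subset fun m hm x => ?_
  have hx : w x * m x ≤ N := by
    rcases eq_or_ne (m x) 0 with h | h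
    · simp [h]
    · exact (Finset.single_le_sum (f := fun x => w x * m x) (fun _ _ => Nat.zero_le _)
        (Finsupp.mem_support_iff.mpr h)).trans hm
  rcases eq_or_ne (m x) 0 with h | h
  · simp [h]
  · have h1 : w x ≤ N := (Nat.le_mul_of_pos_right _ (Nat.pos_of_ne_zero h)).trans hx
    have h2 : m x ≤ N := (Nat.le_mul_of_pos_left _ (hw x)).trans hx
    rw [Finsupp.finsetSum_apply]
    refine h2.trans ?_
    refine le_trans ?_ (Finset.single_le_sum (f := fun y => (Finsupp.single y N : α →₀ ℕ) x)
      (fun _ _ => Nat.zero_le _) ((hfin N).mem_toFinset.mpr h1))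
    simp

theorem wt_levels (m : ℕ+ →₀ ℕ) : wt (levels m) = ((m.sum fun j k => (j : ℕ) * k : ℕ) : ℤ) := by
  induction m using Finsupp.induction_linear with
  | zero => simp
  | add x y hx hy =>
    rw [map_add, map_add, hx, hy, Finsupp.sum_add_index' (by simp) (by intros; ring)]
    push_cast
    rfl
  | single i l => simp [mul_comm]

theorem finite_setOf_two_mul_wt_eq (W : ℤ) : {m : ℕ+ →₀ ℕ | 2 * wt (levels m) = W}.Finite := by
  refine (finite_sum_mul_le (fun j : ℕ+ => (j : ℕ)) (fun j => j.pos) (fun N => ?_)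
    W.toNat).subset fun m hm => ?_
  · exact (Set.finite_Iic (⟨N + 1, by omega⟩ : ℕ+)).subset fun x (hx : (x : ℕ) ≤ N) =>
      show (x : ℕ) ≤ N + 1 by omega
  · simp only [Set.mem_ofPred_eq, wt_levels] at hm ⊢
    omega

/-- The vectors `m` with `2 ∑_j j m_j = W`. -/
noncomputable def ofTwiceWeight (W : ℤ) : Finset (ℕ+ →₀ ℕ) :=
  (finite_setOf_two_mul_wt_eq W).toFinset

theorem mem_ofTwiceWeight {W : ℤ} {m : ℕ+ →₀ ℕ} :
    m ∈ ofTwiceWeight W ↔ 2 * wt (levels m) = W := by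
  simp [ofTwiceWeight]

/-- The product `∏_i [m_i + p_i; m_i]_v` with the vacancy numbers
`p_i = ∑_j min(i,j) (n_j - 2 m_j)` of type `A_1`. -/
noncomputable def binomProd (v : RatFunc ℚ) (n : ℕ →₀ ℤ) (m : ℕ+ →₀ ℕ) : RatFunc ℚ :=
  m.prod fun i k => gaussBinom v (minSum i n - 2 * minSum i (levels m)) k

/-- The summand of the rank one fermionic sum. -/
noncomputable def rankOneTerm (v : RatFunc ℚ) (n c : ℕ →₀ ℤ) (m : ℕ+ →₀ ℕ) : RatFunc ℚ :=
  v ^ (minForm (levels m) (levels m) - minForm (levels m) c) * binomProd v n m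

/-- The rank one fermionic sum with multiplicities `n = a + c`. The constraint
`2 ∑_j j m_j = 1 + ∑_j j n_j` says that the total spin vanishes for `ℓ = -1`. -/
noncomputable def rankOneSum (v : RatFunc ℚ) (a c : ℕ →₀ ℤ) : RatFunc ℚ :=
  ∑ m ∈ ofTwiceWeight (1 + wt (a + c)), rankOneTerm v (a + c) c m

theorem minSum_eq_wt {i : ℕ} {y : ℕ →₀ ℤ} (h : ∀ j, i < j → y j = 0) : minSum i y = wt y := by
  unfold minSum wt
  rw [Finsupp.linearCombination_apply, Finsupp.linearCombination_apply]
  refine Finset.sum_congr rfl fun j hj => ?_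
  have hij : j ≤ i := by
    by_contra hlt
    exact (Finsupp.mem_support_iff.mp hj) (h j (not_le.mp hlt))
  simp [min_eq_right hij]

/-- If the largest level occurring in `m` is at least all levels occurring in `n`, its vacancy
number is `-1`, so the summand vanishes. -/
theorem binomProd_eq_zero (v : RatFunc ℚ) {n : ℕ →₀ ℤ} {m : ℕ+ →₀ ℕ}
    (hm : m ∈ ofTwiceWeight (1 + wt n)) {k : ℕ+} (hk : m k ≠ 0)
    (hn : ∀ j : ℕ, (k : ℕ) < j → n j = 0) : binomProd v n m = 0 := by
  rw [mem_ofTwiceWeight] at hm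
  obtain ⟨K, hK, hmax⟩ := m.support.exists_max_image id ⟨k, Finsupp.mem_support_iff.mpr hk⟩
  have hkK : k ≤ K := hmax k (Finsupp.mem_support_iff.mpr hk)
  refine Finset.prod_eq_zero hK ?_
  dsimp only
  have h1 : minSum K n = wt n := minSum_eq_wt fun j hj => hn j (lt_of_le_of_lt hkK hj)
  have h2 : minSum K (levels m) = wt (levels m) := by
    refine minSum_eq_wt fun j hj => ?_
    have hj0 : 0 < j := by omega
    have := levels_apply m ⟨j, hj0⟩
    rw [PNat.mk_coe] at this
    rw [this]
    by_contra hne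
    have := hmax ⟨j, hj0⟩ (Finsupp.mem_support_iff.mpr (by exact_mod_cast hne))
    exact absurd (show j ≤ (K : ℕ) from this) (not_le.mpr hj)
  rw [h1, h2, show wt n - 2 * wt (levels m) = -1 by omega]
  exact gaussBinom_neg_one v (Finsupp.mem_support_iff.mp hK)

/-- The vector `2 e_{j+1} - e_{j+2} - e_j` is dual to `e_{j+1}` under `min`: it is (minus) a second
difference of the piecewise linear function `min(i, ·)`. -/
theorem minSum_neighbours (i j : ℕ) :
    minSum i (Finsupp.single (j + 2) 1 + Finsupp.single j 1) =
      minSum i (Finsupp.single (j + 1) 2) - if i = j + 1 then 1 else 0 := by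
  simp only [map_add, minSum_single]
  split_ifs <;> omega

/-! ### Vanishing of the rank one sums -/

theorem binomProd_eq_mul (v : RatFunc ℚ) (n : ℕ →₀ ℤ) (m : ℕ+ →₀ ℕ) (s : ℕ+) :
    binomProd v n m = gaussBinom v (minSum s n - 2 * minSum s (levels m)) (m s) *
      (m.erase s).prod fun i k => gaussBinom v (minSum i n - 2 * minSum i (levels m)) k :=
  (Finsupp.mul_prod_erase' m s
    (fun i k => gaussBinom v (minSum i n - 2 * minSum i (levels m)) k)
    fun _ => gaussBinom_zero _ _).symm

/-- Replacing two units at level `j + 1` by one unit at each of the two adjacent levels lowers the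
vacancy number at level `j + 1` by one and leaves the other vacancy numbers unchanged. -/
theorem binomProd_neighbours (v : RatFunc ℚ) (n : ℕ →₀ ℤ) (j : ℕ) (m : ℕ+ →₀ ℕ) :
    binomProd v (n + Finsupp.single (j + 2) 1 + Finsupp.single j 1) m =
      gaussBinom v (minSum (j + 1) (n + Finsupp.single (j + 1) 2) -
          2 * minSum (j + 1) (levels m) - 1) (m j.succPNat) *
        (m.erase j.succPNat).prod fun i k =>
          gaussBinom v (minSum i (n + Finsupp.single (j + 1) 2) - 2 * minSum i (levels m)) k := by
  rw [binomProd_eq_mul v _ m j.succPNat]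
  congr 1
  · rw [Nat.succPNat_coe, Nat.succ_eq_add_one, add_assoc n, map_add, minSum_neighbours, if_pos rfl,
      map_add]
    congr 1
    ring
  · refine Finsupp.prod_congr fun i hi => ?_
    have hij : (i : ℕ) ≠ j + 1 := by
      intro h
      rw [Finsupp.support_erase, Finset.mem_erase] at hi
      exact hi.1 (PNat.eq (by simpa using h))
    rw [add_assoc n, map_add, minSum_neighbours, if_neg hij, map_add, sub_zero]

/-- Removing two units of `n` and one unit of `m` at level `j + 1` leaves all vacancy numbers
unchanged. -/
theorem binomProd_add_single (v : RatFunc ℚ) (n : ℕ →₀ ℤ) (j : ℕ) (m : ℕ+ →₀ ℕ) :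
    binomProd v n m =
      gaussBinom v (minSum (j + 1) (n + Finsupp.single (j + 1) 2) -
          2 * minSum (j + 1) (levels (m + Finsupp.single j.succPNat 1))) (m j.succPNat) *
        ((m + Finsupp.single j.succPNat 1).erase j.succPNat).prod fun i k =>
          gaussBinom v (minSum i (n + Finsupp.single (j + 1) 2) -
            2 * minSum i (levels (m + Finsupp.single j.succPNat 1))) k := by
  have h (i : ℕ) : minSum i (n + Finsupp.single (j + 1) 2) -
      2 * minSum i (levels (m + Finsupp.single j.succPNat 1))
        = minSum i n - 2 * minSum i (levels m) := by
    simp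
    ring
  simp only [h]
  rw [binomProd_eq_mul v n m j.succPNat, Finsupp.erase_add, Finsupp.erase_single, add_zero]
  simp

theorem minForm_add_single (m : ℕ+ →₀ ℕ) (j : ℕ) :
    minForm (levels (m + Finsupp.single j.succPNat 1)) (levels (m + Finsupp.single j.succPNat 1))
      = minForm (levels m) (levels m) + 2 * minSum (j + 1) (levels m) + (j + 1) := by
  simp
  ring

theorem minForm_neighbours (x : ℕ →₀ ℤ) (j : ℕ) :
    minForm x (Finsupp.single (j + 2) 1 + Finsupp.single j 1)
      = minForm x (Finsupp.single (j + 1) 2) - x (j + 1) := by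
  induction x using Finsupp.induction_linear with
  | zero => simp
  | add x y hx hy => simp only [map_add, LinearMap.add_apply, Finsupp.add_apply] at *; linarith
  | single i l =>
    rw [minForm_single_left, minSum_neighbours, minForm_single_left, Finsupp.single_apply]
    split_ifs <;> ring

theorem rankOneTerm_right_of_eq_zero (v : RatFunc ℚ) (n c : ℕ →₀ ℤ) (j : ℕ) {m : ℕ+ →₀ ℕ}
    (hm : m j.succPNat = 0) :
    rankOneTerm v (n + Finsupp.single (j + 1) 2) (c + Finsupp.single (j + 1) 2) m =
      rankOneTerm v (n + Finsupp.single (j + 2) 1 + Finsupp.single j 1)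
        (c + Finsupp.single (j + 2) 1 + Finsupp.single j 1) m := by
  have hl : levels m (j + 1) = 0 := by
    have := levels_apply m j.succPNat
    rw [hm] at this
    simpa using this
  rw [rankOneTerm, rankOneTerm, binomProd_neighbours, binomProd_eq_mul v _ m j.succPNat, hm,
    gaussBinom_zero, gaussBinom_zero, add_assoc c, map_add, map_add, minForm_neighbours, hl,
    sub_zero]

theorem rankOneTerm_left_of_eq_zero (v : RatFunc ℚ) (n c : ℕ →₀ ℤ) (j : ℕ) {m : ℕ+ →₀ ℕ}
    (hm : m j.succPNat = 0) :
    rankOneTerm v (n + Finsupp.single (j + 1) 2) c m =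
      rankOneTerm v (n + Finsupp.single (j + 2) 1 + Finsupp.single j 1) c m := by
  rw [rankOneTerm, rankOneTerm, binomProd_neighbours, binomProd_eq_mul v _ m j.succPNat, hm,
    gaussBinom_zero, gaussBinom_zero]

/-- The first Pascal rule at level `j + 1`; its factor `v ^ m` is absorbed by the change of `c`. -/
theorem rankOneTerm_right_add_single {v : RatFunc ℚ} (hv : v ≠ 0) (hv1 : ∀ j : ℕ, v ^ (j + 1) ≠ 1)
    (n c : ℕ →₀ ℤ) (j : ℕ) (m : ℕ+ →₀ ℕ) :
    rankOneTerm v (n + Finsupp.single (j + 1) 2) (c + Finsupp.single (j + 1) 2)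
        (m + Finsupp.single j.succPNat 1) =
      v ^ (-((j : ℤ) + 1) - minSum (j + 1) c) * rankOneTerm v n c m +
        rankOneTerm v (n + Finsupp.single (j + 2) 1 + Finsupp.single j 1)
          (c + Finsupp.single (j + 2) 1 + Finsupp.single j 1)
          (m + Finsupp.single j.succPNat 1) := by
  have hl : levels m (j + 1) = m j.succPNat := by simpa using levels_apply m j.succPNat
  rw [rankOneTerm, rankOneTerm, rankOneTerm, binomProd_neighbours, binomProd_add_single v n j m,
    binomProd_eq_mul v _ _ j.succPNat, minForm_add_single]
  have hs : (m + Finsupp.single j.succPNat 1 : ℕ+ →₀ ℕ) j.succPNat = m j.succPNat + 1 := by simp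
  rw [hs, Nat.succPNat_coe, Nat.succ_eq_add_one, gaussBinom_pascal hv hv1, add_assoc c,
    map_add (minForm _) c, map_add (minForm _) c, minForm_neighbours]
  simp only [map_add, LinearMap.add_apply, levels_single, minForm_single_left,
    minForm_single_right, minSum_single, Nat.succPNat_coe, Nat.succ_eq_add_one, Nat.cast_one,
    one_mul, min_self, Finsupp.add_apply, Finsupp.single_eq_same, hl]
  set A := minForm (levels m) (levels m)
  set B := minForm (levels m) c
  set C := minSum (j + 1) (levels m)
  set D := minSum (j + 1) c
  set E := m j.succPNat
  push_cast
  rw [show A + 2 * C + (j + 1 : ℤ) - (B + D + (2 * C + 2 * (j + 1)))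
      = (-((j : ℤ) + 1) - D) + (A - B) by ring,
    show A + 2 * C + (j + 1 : ℤ) - (B + D + (2 * C + 2 * (j + 1) - (E + 1)))
      = (-((j : ℤ) + 1) - D) + (A - B) + ((E + 1 : ℕ) : ℤ) by push_cast; ring,
    zpow_add₀ hv (_ + _) ((E + 1 : ℕ) : ℤ), zpow_natCast, zpow_add₀ hv]
  ring

/-- The second Pascal rule at level `j + 1`; its factor `v ^ p` combines with the change of the
quadratic form to a power of `v` independent of `m`. -/
theorem rankOneTerm_left_add_single {v : RatFunc ℚ} (hv : v ≠ 0) (hv1 : ∀ j : ℕ, v ^ (j + 1) ≠ 1)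
    (a c : ℕ →₀ ℤ) (j : ℕ) (m : ℕ+ →₀ ℕ) :
    rankOneTerm v (a + c + Finsupp.single (j + 1) 2) c (m + Finsupp.single j.succPNat 1) =
      v⁻¹ ^ (-((j : ℤ) + 1) - minSum (j + 1) a) * rankOneTerm v (a + c) c m +
        rankOneTerm v (a + c + Finsupp.single (j + 2) 1 + Finsupp.single j 1) c
          (m + Finsupp.single j.succPNat 1) := by
  rw [rankOneTerm, rankOneTerm, rankOneTerm, binomProd_neighbours,
    binomProd_add_single v (a + c) j m, binomProd_eq_mul v _ _ j.succPNat, minForm_add_single]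
  have hs : (m + Finsupp.single j.succPNat 1 : ℕ+ →₀ ℕ) j.succPNat = m j.succPNat + 1 := by simp
  rw [hs, Nat.succPNat_coe, Nat.succ_eq_add_one, gaussBinom_pascal' hv hv1, inv_zpow']
  set p := minSum (j + 1) (a + c + Finsupp.single (j + 1) 2) -
    2 * minSum (j + 1) (levels (m + Finsupp.single j.succPNat 1)) with hp
  have he : minForm (levels m) (levels m) + 2 * minSum (j + 1) (levels m) + (j + 1)
      - minForm (levels (m + Finsupp.single j.succPNat 1)) c + p =
      -(-((j : ℤ) + 1) - minSum (j + 1) a) +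
        (minForm (levels m) (levels m) - minForm (levels m) c) := by
    simp [hp]
    ring
  have h2 := congrArg (v ^ ·) he
  simp only [zpow_add₀ hv _ p, zpow_add₀ hv (-_) (_ - _)] at h2
  linear_combination (gaussBinom v p (m j.succPNat) *
    ((m + Finsupp.single j.succPNat 1).erase j.succPNat).prod fun i k =>
      gaussBinom v (minSum i (a + c + Finsupp.single (j + 1) 2) -
        2 * minSum i (levels (m + Finsupp.single j.succPNat 1))) k) * h2

/-- Summation of a termwise recursion in which the first term on the right lowers `m_s` by one. -/
theorem sum_ofTwiceWeight_recursion {F G H : (ℕ+ →₀ ℕ) → RatFunc ℚ} (r : RatFunc ℚ) (s : ℕ+)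
    (W : ℤ) (h0 : ∀ m, m s = 0 → F m = H m)
    (h1 : ∀ m, F (m + Finsupp.single s 1) = r * G m + H (m + Finsupp.single s 1)) :
    ∑ m ∈ ofTwiceWeight (W + 2 * s), F m =
      r * ∑ m ∈ ofTwiceWeight W, G m + ∑ m ∈ ofTwiceWeight (W + 2 * s), H m := by
  rw [← sub_eq_iff_eq_add, ← Finset.sum_sub_distrib, Finset.mul_sum]
  have hinj : Function.Injective fun m : ℕ+ →₀ ℕ => m + Finsupp.single s 1 :=
    fun x y h => add_right_cancel h
  have hG (m) : r * G m = F (m + Finsupp.single s 1) - H (m + Finsupp.single s 1) := by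
    rw [h1]; ring
  simp only [hG]
  rw [← Finset.sum_image (f := fun m => F m - H m) (g := fun m => m + Finsupp.single s 1)
    (fun x _ y _ h => hinj h)]
  symm
  refine Finset.sum_subset ?_ ?_
  · intro m hm
    obtain ⟨m', hm', rfl⟩ := Finset.mem_image.mp hm
    rw [mem_ofTwiceWeight] at hm' ⊢
    simp
    linarith
  · intro m hm hm'
    rw [sub_eq_zero]
    refine h0 m ?_
    by_contra hne
    refine hm' (Finset.mem_image.mpr ⟨m - Finsupp.single s 1, ?_, ?_⟩)
    · rw [mem_ofTwiceWeight] at hm ⊢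
      have : m = m - Finsupp.single s 1 + Finsupp.single s 1 :=
        (tsub_add_cancel_of_le (by simpa using Nat.one_le_iff_ne_zero.mpr hne)).symm
      rw [this] at hm
      simp only [map_add, levels_single, wt_single, Nat.cast_one, one_mul] at hm
      linarith
    · exact tsub_add_cancel_of_le (by simpa using Nat.one_le_iff_ne_zero.mpr hne)

theorem wt_add_neighbours (n : ℕ →₀ ℤ) (j : ℕ) :
    wt (n + Finsupp.single (j + 2) 1 + Finsupp.single j 1)
      = wt (n + Finsupp.single (j + 1) 2) := by
  simp
  ring

theorem rankOneSum_add_zero_right (v : RatFunc ℚ) (a c : ℕ →₀ ℤ) :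
    rankOneSum v a (c + Finsupp.single 0 1) = rankOneSum v a c := by
  simp [rankOneSum, rankOneTerm, binomProd, ← add_assoc]

theorem rankOneSum_add_zero_left (v : RatFunc ℚ) (a c : ℕ →₀ ℤ) :
    rankOneSum v (a + Finsupp.single 0 1) c = rankOneSum v a c := by
  simp [rankOneSum, rankOneTerm, binomProd, add_right_comm a _ c]

/-- As a function of `c`, the rank one sum is a Q-functional. -/
theorem isQFunctional_right {v : RatFunc ℚ} (hv : v ≠ 0) (hv1 : ∀ j : ℕ, v ^ (j + 1) ≠ 1)
    (a : ℕ →₀ ℤ) : IsQFunctional v (rankOneSum v a) where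
  add_zero_level c := rankOneSum_add_zero_right v a c
  quadratic j c := by
    simp only [rankOneSum, ← add_assoc a]
    rw [wt_add_neighbours,
      show 1 + wt (a + c + Finsupp.single (j + 1) 2) = 1 + wt (a + c) + 2 * (j.succPNat : ℕ) by
        simp; ring]
    exact sum_ofTwiceWeight_recursion _ j.succPNat _
      (fun m hm => rankOneTerm_right_of_eq_zero v _ _ j hm)
      fun m => rankOneTerm_right_add_single hv hv1 _ _ j m

/-- As a function of `a`, the rank one sum is a Q-functional for the parameter `v⁻¹`. -/
theorem isQFunctional_left {v : RatFunc ℚ} (hv : v ≠ 0) (hv1 : ∀ j : ℕ, v ^ (j + 1) ≠ 1)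
    (c : ℕ →₀ ℤ) : IsQFunctional v⁻¹ (fun a => rankOneSum v a c) where
  add_zero_level a := rankOneSum_add_zero_left v a c
  quadratic j a := by
    simp only [rankOneSum, add_right_comm a _ c, add_right_comm _ _ c]
    rw [wt_add_neighbours,
      show 1 + wt (a + c + Finsupp.single (j + 1) 2) = 1 + wt (a + c) + 2 * (j.succPNat : ℕ) by
        simp; ring]
    exact sum_ofTwiceWeight_recursion _ j.succPNat _
      (fun m hm => rankOneTerm_left_of_eq_zero v _ _ j hm)
      fun m => rankOneTerm_left_add_single hv hv1 _ _ j m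

/-- The rank one sum vanishes for nonnegative exponents: it can be reduced to exponents concentrated
at level `1`, where every summand vanishes. -/
theorem rankOneSum_eq_zero {v : RatFunc ℚ} (hv : v ≠ 0) (hv1 : ∀ j : ℕ, v ^ (j + 1) ≠ 1)
    {a c : ℕ →₀ ℤ} (ha : 0 ≤ a) (hc : 0 ≤ c) (ha0 : a 0 = 0) (hc0 : c 0 = 0) :
    rankOneSum v a c = 0 := by
  refine (isQFunctional_right hv hv1 a).eq_zero hv (fun k hk => ?_) hc hc0
  refine (isQFunctional_left hv hv1 _).eq_zero (inv_ne_zero hv) (fun l hl => ?_) ha ha0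
  refine Finset.sum_eq_zero fun m hm => ?_
  rcases eq_or_ne m 0 with rfl | hm0
  · rw [mem_ofTwiceWeight] at hm
    simp at hm
    omega
  · obtain ⟨i, hi⟩ := Finsupp.ne_iff.mp hm0
    rw [rankOneTerm, binomProd_eq_zero v hm hi, mul_zero]
    intro j hj
    have : 1 ≠ j := by have := i.pos; omega
    simp [this]

/-! ### Spans of exponentials, and the dependence on one colour -/

theorem minForm_levels (x : ℕ+ →₀ ℕ) (y : ℕ →₀ ℤ) :
    minForm (levels x) y = x.sum fun i k => (k : ℤ) * minSum i y := by
  induction x using Finsupp.induction_linear with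
  | zero => simp
  | add x x' hx hx' =>
    rw [map_add, map_add, LinearMap.add_apply, hx, hx',
      Finsupp.sum_add_index' (by simp) (by intros; push_cast; ring)]
  | single i l => simp

section ExpSpan

/-- The function `x ↦ v ^ (∑_{i,j} min(i,j) x_i κ_j)`. -/
noncomputable def expFun (v : RatFunc ℚ) (κ : ℕ →₀ ℤ) : (ℕ+ →₀ ℕ) → RatFunc ℚ :=
  fun x => v ^ minForm (levels x) κ

theorem expFun_zero (v : RatFunc ℚ) : expFun v 0 = 1 := by
  ext x; simp [expFun]

theorem expFun_add {v : RatFunc ℚ} (hv : v ≠ 0) (κ κ' : ℕ →₀ ℤ) :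
    expFun v (κ + κ') = expFun v κ * expFun v κ' := by
  ext x; simp [expFun, zpow_add₀ hv]

/-- The span of the exponential functions `expFun v κ` with `0 ≤ κ ≤ N`. -/
noncomputable def expSpan (v : RatFunc ℚ) (N : ℕ →₀ ℤ) :
    Submodule (RatFunc ℚ) ((ℕ+ →₀ ℕ) → RatFunc ℚ) :=
  Submodule.span _ (expFun v '' Set.Icc 0 N)

theorem expFun_mem_expSpan (v : RatFunc ℚ) {κ N : ℕ →₀ ℤ} (h0 : 0 ≤ κ) (hN : κ ≤ N) :
    expFun v κ ∈ expSpan v N :=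
  Submodule.subset_span ⟨κ, ⟨h0, hN⟩, rfl⟩

theorem const_mem_expSpan (v r : RatFunc ℚ) {N : ℕ →₀ ℤ} (hN : 0 ≤ N) :
    (fun _ => r) ∈ expSpan v N := by
  have := (expSpan v N).smul_mem r (expFun_mem_expSpan v le_rfl hN)
  rw [expFun_zero] at this
  convert this using 1
  ext x
  simp

theorem mul_mem_expSpan {v : RatFunc ℚ} (hv : v ≠ 0) {N N' : ℕ →₀ ℤ}
    {g g' : (ℕ+ →₀ ℕ) → RatFunc ℚ} (hg : g ∈ expSpan v N) (hg' : g' ∈ expSpan v N') :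
    g * g' ∈ expSpan v (N + N') := by
  have h := Submodule.mul_mem_mul hg hg'
  rw [expSpan, expSpan, Submodule.span_mul_span] at h
  refine Submodule.span_mono ?_ h
  rintro _ ⟨_, ⟨κ, hκ, rfl⟩, _, ⟨κ', hκ', rfl⟩, rfl⟩
  exact ⟨κ + κ', ⟨add_nonneg hκ.1 hκ'.1, add_le_add hκ.2 hκ'.2⟩, expFun_add hv κ κ'⟩

theorem prod_mem_expSpan {v : RatFunc ℚ} (hv : v ≠ 0) {α : Type*} (s : Finset α)
    {N : α → ℕ →₀ ℤ} {g : α → (ℕ+ →₀ ℕ) → RatFunc ℚ} (h : ∀ y ∈ s, g y ∈ expSpan v (N y)) :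
    ∏ y ∈ s, g y ∈ expSpan v (∑ y ∈ s, N y) := by
  classical
  induction s using Finset.induction_on with
  | empty => exact const_mem_expSpan v 1 le_rfl
  | insert y s hy ih =>
    rw [Finset.prod_insert hy, Finset.sum_insert hy]
    exact mul_mem_expSpan hv (h y (Finset.mem_insert_self y s))
      (ih fun z hz => h z (Finset.mem_insert_of_mem hz))

/-- A Gaussian binomial `[m + p; m]_u` is a polynomial in `u ^ p` of degree at most `m`. -/
theorem gaussBinom_mem_expSpan {v u : RatFunc ℚ} (hv : v ≠ 0) (hu : u ≠ 0) {e : ℤ} (he : 0 ≤ e)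
    {c : ℤ} (huv : u ^ (-c) = v ^ e) (p : ℤ) (j m : ℕ) :
    (fun x => gaussBinom u (p - c * minSum j (levels x)) m) ∈
      expSpan v (Finsupp.single j (e * m)) := by
  have h : ∀ l ∈ Finset.Icc 1 m, (fun x => (1 - u ^ (p - c * minSum j (levels x) + (l : ℤ))) /
      (1 - u ^ l)) ∈ expSpan v (Finsupp.single j e) := by
    intro l _
    have h1 := const_mem_expSpan v (1 / (1 - u ^ l))
      (N := Finsupp.single j e) (by simpa using he)
    have h2 := (expSpan v (Finsupp.single j e)).smul_mem (-u ^ (p + l) / (1 - u ^ l))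
      (expFun_mem_expSpan v (κ := Finsupp.single j e) (by simpa using he) le_rfl)
    convert add_mem h1 h2 using 1
    ext x
    have h3 : u ^ (p - c * minSum j (levels x) + (l : ℤ))
        = u ^ (p + l) * v ^ (e * minSum j (levels x)) := by
      rw [zpow_mul, ← huv, ← zpow_mul, ← zpow_add₀ hu]
      congr 1
      ring
    simp only [Pi.add_apply, Pi.smul_apply, smul_eq_mul, expFun, minForm_single_right, h3]
    ring
  have h' := prod_mem_expSpan hv _ h
  rw [Finset.sum_const, Nat.card_Icc, Finsupp.smul_single, Nat.add_sub_cancel, nsmul_eq_mul,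
    mul_comm] at h'
  convert h' using 1
  ext x
  simp [gaussBinom, Finset.prod_apply]

end ExpSpan

/-- Inserting a combination of exponentials `expFun v κ`, `0 ≤ κ ≤ N ≤ n`, into the rank one sum
gives zero: each exponential turns the sum into the one with `a = κ` and `c = n - κ`. -/
theorem sum_expSpan_eq_zero {v : RatFunc ℚ} (hv : v ≠ 0) (hv1 : ∀ j : ℕ, v ^ (j + 1) ≠ 1)
    {n N : ℕ →₀ ℤ} (hN : N ≤ n) (hn0 : n 0 = 0) {g : (ℕ+ →₀ ℕ) → RatFunc ℚ}
    (hg : g ∈ expSpan v N) :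
    ∑ x ∈ ofTwiceWeight (1 + wt n), rankOneTerm v n n x * g x = 0 := by
  induction hg using Submodule.span_induction with
  | mem g hg =>
    obtain ⟨κ, ⟨hκ0, hκN⟩, rfl⟩ := hg
    have hκn : κ ≤ n := hκN.trans hN
    have h0 : κ 0 = 0 := le_antisymm (hn0 ▸ hκn 0) (hκ0 0)
    have := rankOneSum_eq_zero hv hv1 hκ0 (sub_nonneg.mpr hκn) h0 (by simp [h0, hn0])
    rw [rankOneSum, add_sub_cancel] at this
    rw [← this]
    refine Finset.sum_congr rfl fun x _ => ?_
    rw [rankOneTerm, rankOneTerm, expFun, mul_right_comm, ← zpow_add₀ hv, map_sub]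
    congr 2
    ring
  | zero => simp
  | add g g' _ _ ih ih' => simp [mul_add, Finset.sum_add_distrib, ih, ih']
  | smul r g _ ih =>
    simp only [Pi.smul_apply, smul_eq_mul, mul_left_comm _ r]
    rw [← Finset.mul_sum, ih, mul_zero]

theorem coe_min_pnat (i j : ℕ+) : ((min i j : ℕ+) : ℕ) = min (i : ℕ) j :=
  (Subtype.mono_coe fun k : ℕ => 0 < k).map_min

section Colors

variable {ι : Type}

/-- The vector `∑_b C_{ab} m_{b,j}`, `j ≥ 1`. -/
noncomputable def rowSum (C : Matrix ι ι ℤ) (a : ι) : (ι × ℕ+ →₀ ℕ) →+ (ℕ →₀ ℤ) :=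
  Finsupp.liftAddHom fun y => (Finsupp.singleAddHom (y.2 : ℕ)).comp
    ((AddMonoidHom.mulLeft (C a y.1)).comp (Nat.castAddMonoidHom ℤ))

theorem rowSum_eq_sum (C : Matrix ι ι ℤ) (a : ι) (m : ι × ℕ+ →₀ ℕ) :
    rowSum C a m = m.sum fun y k => Finsupp.single (y.2 : ℕ) (C a y.1 * k) := rfl

theorem rowSum_apply_zero (C : Matrix ι ι ℤ) (a : ι) (m : ι × ℕ+ →₀ ℕ) : rowSum C a m 0 = 0 := by
  rw [rowSum_eq_sum, Finsupp.sum_apply]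
  exact Finset.sum_eq_zero fun y _ => Finsupp.single_eq_of_ne y.2.ne_zero.symm

/-- A vector of multiplicities, placed at the colour `a`. -/
noncomputable def colour (a : ι) : (ℕ+ →₀ ℕ) →+ (ι × ℕ+ →₀ ℕ) :=
  Finsupp.mapDomain.addMonoidHom (Prod.mk a)

theorem colour_apply [DecidableEq ι] (a : ι) (x : ℕ+ →₀ ℕ) (y : ι × ℕ+) :
    colour a x y = if y.1 = a then x y.2 else 0 := by
  obtain ⟨b, i⟩ := y
  change Finsupp.mapDomain (Prod.mk a) x (b, i) = _
  split_ifs with h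
  · dsimp only at h
    subst h
    exact Finsupp.mapDomain_apply (Prod.mk_right_injective b) x i
  · refine Finsupp.mapDomain_of_notMem_range _ _ ?_
    rintro ⟨j, hj⟩
    exact h (congrArg Prod.fst hj).symm

theorem colour_single (a : ι) (i : ℕ+) (k : ℕ) :
    colour a (Finsupp.single i k) = Finsupp.single (a, i) k :=
  Finsupp.mapDomain_single

theorem prod_colour (a : ι) (x : ℕ+ →₀ ℕ) (f : ι × ℕ+ → ℕ → RatFunc ℚ) :
    (colour a x).prod f = x.prod fun i k => f (a, i) k :=
  Finsupp.prod_mapDomain_index_inj (Prod.mk_right_injective a)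

theorem rowSum_colour (C : Matrix ι ι ℤ) (a b : ι) (x : ℕ+ →₀ ℕ) :
    rowSum C b (colour a x) = C b a • levels x := by
  induction x using Finsupp.induction_linear with
  | zero => simp
  | add x x' hx hx' => simp [hx, hx']
  | single i l => simp [colour_single, rowSum_eq_sum]

theorem totalSpin_eq [DecidableEq ι] (C : Matrix ι ι ℤ) (ℓ : ι → ℕ) (n m : ι × ℕ+ →₀ ℕ) (a : ι) :
    totalSpin C ℓ n m a = ℓ a + wt (rowSum C a m) - wt (rowSum 1 a n) := by
  rw [totalSpin, rowSum_eq_sum, rowSum_eq_sum, map_finsuppSum, map_finsuppSum]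
  congr 1
  · congr 1
    exact Finsupp.sum_congr fun y _ => by rw [wt_single]; ring
  · refine Finsupp.sum_congr fun y _ => ?_
    rw [wt_single, Matrix.one_apply]
    by_cases h : y.1 = a
    · simp [h, mul_comm]
    · simp [h, Ne.symm h]

theorem vacancy_eq [DecidableEq ι] (C : Matrix ι ι ℤ) (n m : ι × ℕ+ →₀ ℕ) (a : ι) (i : ℕ+) :
    vacancy C n m a i = minSum i (rowSum 1 a n) - minSum i (rowSum C a m) := by
  rw [vacancy, rowSum_eq_sum, rowSum_eq_sum, map_finsuppSum, map_finsuppSum]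
  congr 1
  · refine Finsupp.sum_congr fun y _ => ?_
    rw [minSum_single, Matrix.one_apply, coe_min_pnat]
    by_cases h : y.1 = a
    · simp [h, mul_comm]
    · simp [h, Ne.symm h]
  · exact Finsupp.sum_congr fun y _ => by rw [minSum_single, coe_min_pnat]; ring

/-- The bilinear form `∑_{i,j} ∑_{a,b} t_a min(i,j) m_{a,i} C_{ab} m'_{b,j}`. -/
noncomputable def colourForm (C : Matrix ι ι ℤ) (t : ι → ℤ) (m m' : ι × ℕ+ →₀ ℕ) : ℤ :=
  m.sum fun y k => t y.1 * k * minSum y.2 (rowSum C y.1 m')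

theorem colourForm_add_left (C : Matrix ι ι ℤ) (t : ι → ℤ) (m₁ m₂ m' : ι × ℕ+ →₀ ℕ) :
    colourForm C t (m₁ + m₂) m' = colourForm C t m₁ m' + colourForm C t m₂ m' :=
  Finsupp.sum_add_index' (by simp) (by intros; push_cast; ring)

theorem colourForm_add_right (C : Matrix ι ι ℤ) (t : ι → ℤ) (m m₁ m₂ : ι × ℕ+ →₀ ℕ) :
    colourForm C t m (m₁ + m₂) = colourForm C t m m₁ + colourForm C t m m₂ := by
  simp only [colourForm, map_add, mul_add, Finsupp.sum_add]

theorem colourForm_colour_left (C : Matrix ι ι ℤ) (t : ι → ℤ) (a : ι) (x : ℕ+ →₀ ℕ)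
    (m : ι × ℕ+ →₀ ℕ) :
    colourForm C t (colour a x) m = t a * minForm (levels x) (rowSum C a m) := by
  induction x using Finsupp.induction_linear with
  | zero => simp [colourForm]
  | add x x' hx hx' => simp only [map_add, colourForm_add_left, LinearMap.add_apply, hx, hx']; ring
  | single i l => simp [colour_single, colourForm, mul_assoc]

theorem colourForm_comm {C : Matrix ι ι ℤ} {t : ι → ℤ} (ht : ∀ a b, t a * C a b = t b * C b a)
    (m m' : ι × ℕ+ →₀ ℕ) : colourForm C t m m' = colourForm C t m' m := by
  induction m using Finsupp.induction_linear with
  | zero => simp [colourForm]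
  | add x x' hx hx' => rw [colourForm_add_left, colourForm_add_right, hx, hx']
  | single y k =>
    induction m' using Finsupp.induction_linear with
    | zero => simp [colourForm]
    | add x x' hx hx' => rw [colourForm_add_left, colourForm_add_right, hx, hx']
    | single z l =>
      simp only [colourForm, rowSum_eq_sum, Nat.cast_zero, mul_zero, Finsupp.single_zero,
        Finsupp.sum_single_index, minSum_single, zero_mul, min_comm (z.2 : ℕ)]
      linear_combination (k * l * min (y.2 : ℕ) (z.2 : ℕ) : ℤ) * ht y.1 z.1

theorem quadPart_eq (C : Matrix ι ι ℤ) (t : ι → ℤ) (m : ι × ℕ+ →₀ ℕ) :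
    quadPart C t m = colourForm C t m m := by
  refine Finsupp.sum_congr fun y _ => ?_
  rw [rowSum_eq_sum, map_finsuppSum, Finsupp.mul_sum]
  refine Finsupp.sum_congr fun z _ => ?_
  rw [minSum_single, coe_min_pnat]
  ring

theorem linPart_eq [DecidableEq ι] (t : ι → ℤ) (n m : ι × ℕ+ →₀ ℕ) :
    linPart t n m = colourForm 1 t m n := by
  refine Finsupp.sum_congr fun y _ => ?_
  rw [rowSum_eq_sum, map_finsuppSum, Finsupp.mul_sum]
  refine Finsupp.sum_congr fun z _ => ?_
  rw [minSum_single, coe_min_pnat, Matrix.one_apply]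
  split_ifs <;> ring

theorem quadForm_add_colour [DecidableEq ι] {C : Matrix ι ι ℤ} {t : ι → ℤ} (hC : ∀ a, C a a = 2)
    (ht : ∀ a b, t a * C a b = t b * C b a) (n μ : ι × ℕ+ →₀ ℕ) (a : ι) (x : ℕ+ →₀ ℕ) :
    quadForm C t n (μ + colour a x) = quadForm C t n μ + t a * (minForm (levels x) (levels x)
      - minForm (levels x) (rowSum 1 a n - rowSum C a μ)) := by
  have h1 := two_mul_quadForm C t hC ht n (μ + colour a x)
  have h2 := two_mul_quadForm C t hC ht n μ
  rw [quadPart_eq, linPart_eq] at h1 h2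
  simp only [colourForm_add_left, colourForm_add_right, colourForm_comm ht μ (colour a x),
    colourForm_colour_left, rowSum_colour, hC, map_smul, smul_eq_mul] at h1
  rw [map_sub]
  linarith

theorem vacancy_add_colour [DecidableEq ι] (C : Matrix ι ι ℤ) (n μ : ι × ℕ+ →₀ ℕ) (a b : ι) (x : ℕ+ →₀ ℕ)
    (i : ℕ+) :
    vacancy C n (μ + colour a x) b i = vacancy C n μ b i - C b a * minSum i (levels x) := by
  rw [vacancy_eq, vacancy_eq, map_add, rowSum_colour, map_add, map_smul, smul_eq_mul]
  ring

theorem totalSpin_add_colour [DecidableEq ι] (C : Matrix ι ι ℤ) (ℓ : ι → ℕ) (n μ : ι × ℕ+ →₀ ℕ) (a b : ι)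
    (x : ℕ+ →₀ ℕ) :
    totalSpin C ℓ n (μ + colour a x) b = totalSpin C ℓ n μ b + C b a * wt (levels x) := by
  rw [totalSpin_eq, totalSpin_eq, map_add, rowSum_colour, map_add, map_smul, smul_eq_mul]
  ring

end Colors

/-! ### Cancellation with the other colours fixed -/

/-- Below level `k`, the levels above `k` enter `minSum` only through their mass. -/
theorem minSum_eq_filter {i k : ℕ} (h : i ≤ k) (y : ℕ →₀ ℤ) :
    minSum i y = minSum i (y.filter (· ≤ k)) + i * (minSum (k + 1) y - minSum k y) := by
  induction y using Finsupp.induction_linear with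
  | zero => simp [Finsupp.filter_zero]
  | add y y' hy hy' => rw [map_add, hy, hy', Finsupp.filter_add]; simp only [map_add]; ring
  | single j l =>
    by_cases hj : j ≤ k
    · rw [Finsupp.filter_single_of_pos (· ≤ k) hj]
      simp [min_eq_right hj, min_eq_right (hj.trans (Nat.le_succ k))]
    · rw [Finsupp.filter_single_of_neg (· ≤ k) hj]
      have h1 : min k j = k := by omega
      have h2 : min (k + 1) j = k + 1 := by omega
      have h3 : min i j = i := by omega
      simp only [minSum_single, h1, h2, h3, map_zero]
      push_cast
      ring

/-- The vector that agrees with `ν` below level `k`, has the same value of `minSum i` for `i ≤ k`,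
vanishes above level `k + 1`, and has weight `w - 1`. -/
noncomputable def truncation (ν : ℕ →₀ ℤ) (k : ℕ) (w : ℤ) : ℕ →₀ ℤ :=
  ν.filter (· ≤ k) + Finsupp.single k (minSum (k + 1) ν - w + 1)
    + Finsupp.single (k + 1) (w - minSum k ν - 1)

theorem minSum_truncation {i k : ℕ} (h : i ≤ k) (ν : ℕ →₀ ℤ) (w : ℤ) :
    minSum i (truncation ν k w) = minSum i ν := by
  rw [truncation, minSum_eq_filter h ν, map_add, map_add, minSum_single, minSum_single,
    min_eq_left h, min_eq_left (h.trans (Nat.le_succ k))]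
  ring

theorem wt_truncation (ν : ℕ →₀ ℤ) (k : ℕ) (w : ℤ) : 1 + wt (truncation ν k w) = w := by
  have h1 := minSum_eq_filter le_rfl (k := k) ν
  have h2 : minSum k (ν.filter (· ≤ k)) = wt (ν.filter (· ≤ k)) :=
    minSum_eq_wt fun j hj => Finsupp.filter_apply_neg _ _ (by simpa using hj)
  rw [truncation, map_add, map_add, wt_single, wt_single, ← h2]
  push_cast
  linear_combination -h1

theorem truncation_apply_zero {ν : ℕ →₀ ℤ} (hν : ν 0 = 0) {k : ℕ} (hk : 0 < k) (w : ℤ) :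
    truncation ν k w 0 = 0 := by
  simp [truncation, hν, hk.ne']

theorem truncation_apply_of_lt (ν : ℕ →₀ ℤ) {j k : ℕ} (h : k + 1 < j) (w : ℤ) :
    truncation ν k w j = 0 := by
  simp [truncation, show ¬ j ≤ k by omega, show k ≠ j by omega,
    show k + 1 ≠ j by omega]

theorem filter_le_truncation {ν : ℕ →₀ ℤ} {k : ℕ} {w : ℤ} (h1 : minSum k ν < w)
    (h2 : w ≤ minSum (k + 1) ν) : ν.filter (· ≤ k) ≤ truncation ν k w := by
  rw [truncation, add_assoc]
  refine le_add_of_nonneg_right (add_nonneg ?_ ?_)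
  · exact Finsupp.single_nonneg.mpr (by omega)
  · exact Finsupp.single_nonneg.mpr (by omega)

section Fibre

variable {ι : Type} [DecidableEq ι]

/-- The properties of the Cartan matrix `C` and the symmetrizing integers `t` that are used: `C` is
a nonsingular generalized Cartan matrix, symmetrized by the positive integers `t`. -/
structure IsSymmetrizedCartan [Fintype ι] (C : Matrix ι ι ℤ) (t : ι → ℤ) : Prop where
  diag : ∀ a, C a a = 2
  offDiag : ∀ a b, a ≠ b → C a b ≤ 0
  pos : ∀ a, 0 < t a
  symm : ∀ a b, t a * C a b = t b * C b a
  nonsing : ∀ x : ι → ℤ, (∀ a, ∑ b, C a b * x b = 0) → x = 0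

theorem X_zpow_ne_zero (e : ℤ) : (RatFunc.X : RatFunc ℚ) ^ e ≠ 0 :=
  zpow_ne_zero _ RatFunc.X_ne_zero

theorem X_zpow_pow_ne_one {e : ℤ} (he : 0 < e) (j : ℕ) :
    ((RatFunc.X : RatFunc ℚ) ^ e) ^ (j + 1) ≠ 1 := by
  lift e to ℕ using he.le
  rw [zpow_natCast, ← pow_mul]
  intro h
  have h' : (algebraMap (Polynomial ℚ) (RatFunc ℚ)) (Polynomial.X ^ (e * (j + 1)))
      = (algebraMap (Polynomial ℚ) (RatFunc ℚ)) 1 := by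
    rw [map_pow, RatFunc.algebraMap_X, h, map_one]
  have h2 := congrArg Polynomial.natDegree (RatFunc.algebraMap_injective ℚ h')
  rw [Polynomial.natDegree_X_pow, Polynomial.natDegree_one] at h2
  have : 0 < e := by exact_mod_cast he
  exact (Nat.mul_pos this (Nat.succ_pos j)).ne' h2

variable [Fintype ι] {C : Matrix ι ι ℤ} {t : ι → ℤ}

/-- Sum over the multiplicities `x` of colour `a` and level at most `k`, all others being given by
`μ`. The bounds `h1` and `h2` say that the vacancy numbers of colour `a` are negative at level `k`
and nonnegative at level `k + 1`. As functions of `x`, the factors of the other colours lie in an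
`expSpan`, so the sum is a combination of rank one sums. -/
theorem sum_fibre_eq_zero (h : IsSymmetrizedCartan C t) (n μ : ι × ℕ+ →₀ ℕ) (a : ι) (k : ℕ+)
    (hμ : ∀ i ≤ k, μ (a, i) = 0) (ω : ℤ)
    (h1 : minSum k (rowSum 1 a n - rowSum C a μ) < 2 * ω)
    (h2 : 2 * ω ≤ minSum (k + 1) (rowSum 1 a n - rowSum C a μ)) {s : Finset (ℕ+ →₀ ℕ)}
    (hs : ∀ x, x ∈ s ↔ 2 * wt (levels x) = 2 * ω ∧ ∀ i, k < i → x i = 0) :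
    ∑ x ∈ s, summand C t n (μ + colour a x) = 0 := by
  classical
  obtain rfl : s = (ofTwiceWeight (2 * ω)).filter fun x => ∀ i, k < i → x i = 0 := by
    ext x
    rw [hs, Finset.mem_filter, mem_ofTwiceWeight]
  set ν := rowSum 1 a n - rowSum C a μ with hν
  set v : RatFunc ℚ := RatFunc.X ^ t a with hvdef
  have hv : v ≠ 0 := X_zpow_ne_zero _
  set nt := truncation ν k (2 * ω) with hnt
  -- For `y` of level above `k` the vacancy number depends on `x` only through its weight `ω`.
  let g (y : ι × ℕ+) (x : ℕ+ →₀ ℕ) : RatFunc ℚ := gaussBinom (RatFunc.X ^ t y.1)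
    (vacancy C n μ y.1 y.2 - C y.1 a * if y.2 ≤ k then minSum y.2 (levels x) else ω) (μ y)
  let N (y : ι × ℕ+) : ℕ →₀ ℤ := (Finsupp.single (y.2 : ℕ) (-C a y.1 * μ y)).filter (· ≤ (k : ℕ))
  have hg : ∏ y ∈ μ.support, g y ∈ expSpan v (∑ y ∈ μ.support, N y) := by
    refine prod_mem_expSpan hv _ fun y hy => ?_
    by_cases hyk : y.2 ≤ k
    · have hya : a ≠ y.1 := by
        rintro rfl
        exact Finsupp.mem_support_iff.mp hy (hμ y.2 hyk)
      simp only [g, N, hyk, if_true]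
      rw [Finsupp.filter_single_of_pos (· ≤ (k : ℕ)) (show (y.2 : ℕ) ≤ k from hyk)]
      refine gaussBinom_mem_expSpan hv (X_zpow_ne_zero _)
        (neg_nonneg.mpr (h.offDiag a y.1 hya)) ?_ _ _ _
      rw [hvdef, ← zpow_mul, ← zpow_mul]
      congr 1
      linear_combination h.symm a y.1
    · simp only [g, N, hyk, if_false]
      rw [Finsupp.filter_single_of_neg (· ≤ (k : ℕ)) (show ¬ (y.2 : ℕ) ≤ k from hyk)]
      exact const_mem_expSpan v _ le_rfl
  have hN : ∑ y ∈ μ.support, N y ≤ nt := by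
    refine le_trans ?_ (filter_le_truncation h1 h2)
    have hsum : ν = rowSum 1 a n + ∑ y ∈ μ.support, Finsupp.single (y.2 : ℕ) (-C a y.1 * μ y) := by
      rw [hν, rowSum_eq_sum C a μ, Finsupp.sum, sub_eq_add_neg, ← Finset.sum_neg_distrib]
      simp
    have hfilter := congrArg (Finsupp.filterAddHom (· ≤ (k : ℕ))) hsum
    rw [map_add, map_sum] at hfilter
    change ν.filter _ = (rowSum 1 a n).filter _ + ∑ y ∈ μ.support, N y at hfilter
    rw [hfilter]
    refine le_add_of_nonneg_left fun j => ?_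
    rw [Finsupp.filter_apply]
    split_ifs
    · rw [rowSum_eq_sum, Finsupp.sum_apply]
      refine Finset.sum_nonneg fun y _ => ?_
      have : (0 : ℤ) ≤ (1 : Matrix ι ι ℤ) a y.1 * n y := by
        rw [Matrix.one_apply]
        split_ifs <;> simp
      exact Finsupp.single_nonneg.mpr this j
    · exact le_rfl
  have hν0 : ν 0 = 0 := by rw [hν, Finsupp.sub_apply, rowSum_apply_zero, rowSum_apply_zero, sub_zero]
  have key := sum_expSpan_eq_zero hv (X_zpow_pow_ne_one (h.pos a)) hN
    (truncation_apply_zero hν0 k.pos _) hg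
  rw [wt_truncation] at key
  rw [← mul_zero ((RatFunc.X : RatFunc ℚ) ^ quadForm C t n μ), ← key, Finset.mul_sum,
    Finset.sum_filter]
  refine Finset.sum_congr rfl fun x hx => ?_
  split_ifs with hxk
  · have hxk' (i : ℕ) (hi : (k : ℕ) < i) : levels x i = 0 := by
      have hi0 : 0 < i := by omega
      have := levels_apply x ⟨i, hi0⟩
      rw [hxk ⟨i, hi0⟩ hi] at this
      simpa using this
    have hwt : wt (levels x) = ω := by
      rw [mem_ofTwiceWeight] at hx
      omega
    have hsupp (i : ℕ+) (hi : i ∈ x.support) : (i : ℕ) ≤ k := by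
      by_contra hlt
      exact Finsupp.mem_support_iff.mp hi (hxk i (not_le.mp hlt))
    have hform : minForm (levels x) nt = minForm (levels x) ν := by
      rw [minForm_levels, minForm_levels]
      exact Finsupp.sum_congr fun i hi => by rw [hnt, minSum_truncation (hsupp i hi)]
    have hbinom : ((colour a x).prod fun y l => gaussBinom (RatFunc.X ^ t y.1)
        (vacancy C n (μ + colour a x) y.1 y.2) l) = binomProd v nt x := by
      rw [prod_colour]
      refine Finsupp.prod_congr fun i hi => ?_
      rw [vacancy_add_colour, vacancy_eq, h.diag, hnt, minSum_truncation (hsupp i hi), hν, map_sub]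
    have hprod : (μ.prod fun y l => gaussBinom (RatFunc.X ^ t y.1)
        (vacancy C n (μ + colour a x) y.1 y.2) l) = (∏ y ∈ μ.support, g y) x := by
      rw [Finset.prod_apply]
      refine Finset.prod_congr rfl fun y _ => ?_
      simp only [g]
      rw [vacancy_add_colour]
      split_ifs with hyk
      · rfl
      · rw [minSum_eq_wt fun j hj => hxk' j ((not_le.mp hyk : (k : ℕ) < y.2).trans hj), hwt]
    have hdisj : Disjoint μ.support (colour a x).support := by
      rw [Finset.disjoint_left]
      intro y hy hy'
      rw [Finsupp.mem_support_iff, colour_apply] at hy'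
      split_ifs at hy' with hya
      · have hyk := hsupp y.2 (Finsupp.mem_support_iff.mpr hy')
        exact Finsupp.mem_support_iff.mp hy (by rw [← hμ y.2 hyk, ← hya])
      · exact hy' rfl
    rw [summand, Finsupp.prod_add_index_of_disjoint hdisj, hbinom, hprod,
      quadForm_add_colour h.diag h.symm, zpow_add₀ RatFunc.X_ne_zero, zpow_mul, ← hvdef, ← hν,
      rankOneTerm, hform]
    ring
  · -- The rank one sum also runs over `x` reaching beyond level `k`; these contribute zero.
    push Not at hxk
    obtain ⟨i, hki, hi⟩ := hxk
    rw [rankOneTerm, binomProd_eq_zero v (n := nt) (by rwa [hnt, wt_truncation]) hi, mul_zero,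
      zero_mul, mul_zero]
    intro j hj
    refine truncation_apply_of_lt ν ?_ _
    have : (k : ℕ) < i := hki
    omega

end Fibre

/-! ### Cancellation of the summands with a negative vacancy number -/

theorem rowSum_apply_of_lt {ι : Type} (C : Matrix ι ι ℤ) (a : ι) {m : ι × ℕ+ →₀ ℕ} {K : ℕ}
    (hK : ∀ y ∈ m.support, (y.2 : ℕ) ≤ K) {j : ℕ} (hj : K < j) : rowSum C a m j = 0 := by
  rw [rowSum_eq_sum, Finsupp.sum_apply]
  refine Finset.sum_eq_zero fun y hy => Finsupp.single_eq_of_ne ?_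
  have := hK y hy
  omega

section Global

variable {ι : Type} [DecidableEq ι]

theorem exists_add_colour (m : ι × ℕ+ →₀ ℕ) (a : ι) (k : ℕ+) :
    ∃ x : ℕ+ →₀ ℕ, (∀ i, k < i → x i = 0) ∧
      m = m.filter (fun y => ¬ (y.1 = a ∧ y.2 ≤ k)) + colour a x := by
  classical
  refine ⟨(m.comapDomain (Prod.mk a) (Prod.mk_right_injective a).injOn).filter (· ≤ k),
    fun i hi => Finsupp.filter_apply_neg _ _ (not_le.mpr hi), ?_⟩
  ext ⟨b, i⟩
  rw [Finsupp.add_apply, colour_apply, Finsupp.filter_apply, Finsupp.filter_apply,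
    Finsupp.comapDomain_apply]
  by_cases hb : b = a
  · subst hb
    by_cases hi : i ≤ k <;> simp [hi]
  · simp [hb]

theorem filter_add_colour {μ : ι × ℕ+ →₀ ℕ} {a : ι} {k : ℕ+} (hμ : ∀ i ≤ k, μ (a, i) = 0)
    {x : ℕ+ →₀ ℕ} (hx : ∀ i, k < i → x i = 0) :
    (μ + colour a x).filter (fun y => ¬ (y.1 = a ∧ y.2 ≤ k)) = μ := by
  classical
  ext ⟨b, i⟩
  rw [Finsupp.filter_apply, Finsupp.add_apply, colour_apply]
  by_cases hb : b = a
  · subst hb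
    by_cases hi : i ≤ k
    · simp [hi, hμ i hi]
    · simp [hi, hx i (not_le.mp hi)]
  · simp [hb]

theorem minSum_levels_eq_wt {x : ℕ+ →₀ ℕ} {k i : ℕ+} (hx : ∀ j, k < j → x j = 0) (hi : k ≤ i) :
    minSum i (levels x) = wt (levels x) := by
  refine minSum_eq_wt fun j hj => ?_
  have hj0 : 0 < j := by omega
  have := levels_apply x ⟨j, hj0⟩
  rw [hx ⟨j, hj0⟩ (lt_of_le_of_lt hi hj)] at this
  simpa using this

/-- For large `i` the vacancy number is `ℓ_a`. -/
theorem exists_vacancy_eq {C : Matrix ι ι ℤ} {ℓ : ι → ℕ} {n m : ι × ℕ+ →₀ ℕ}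
    (hm : m ∈ admissible C ℓ n) : ∃ K : ℕ, ∀ a, ∀ i : ℕ+, K ≤ i → vacancy C n m a i = ℓ a := by
  refine ⟨(n.support ∪ m.support).sup fun y => (y.2 : ℕ), fun a i hi => ?_⟩
  have hle (y) (hy : y ∈ n.support ∪ m.support) : (y.2 : ℕ) ≤ i :=
    (Finset.le_sup (f := fun y : ι × ℕ+ => (y.2 : ℕ)) hy).trans hi
  have h0 := hm a
  rw [totalSpin_eq] at h0
  rw [vacancy_eq,
    minSum_eq_wt fun j hj => rowSum_apply_of_lt 1 a
      (fun y hy => hle y (Finset.mem_union_left _ hy)) hj,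
    minSum_eq_wt fun j hj => rowSum_apply_of_lt C a
      (fun y hy => hle y (Finset.mem_union_right _ hy)) hj]
  omega

theorem wt_rowSum [Fintype ι] (C : Matrix ι ι ℤ) (a : ι) (m : ι × ℕ+ →₀ ℕ) :
    wt (rowSum C a m) = ∑ b, C a b * wt (rowSum 1 b m) := by
  induction m using Finsupp.induction_linear with
  | zero => simp
  | add x x' hx hx' => simp only [map_add, hx, hx', mul_add, Finset.sum_add_distrib]
  | single y k =>
    simp [rowSum_eq_sum, Matrix.one_apply, mul_assoc, -Finsupp.single_mul]

theorem sum_wt_rowSum_one [Fintype ι] (m : ι × ℕ+ →₀ ℕ) :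
    ∑ b, wt (rowSum 1 b m) = ((m.sum fun y k => (y.2 : ℕ) * k : ℕ) : ℤ) := by
  induction m using Finsupp.induction_linear with
  | zero => simp
  | add x x' hx hx' =>
    rw [Finsupp.sum_add_index' (by simp) (by intros; ring)]
    simp only [map_add, Finset.sum_add_distrib, hx, hx']
    push_cast
    rfl
  | single y k => simp [rowSum_eq_sum, Matrix.one_apply, mul_comm]

variable [Fintype ι] {C : Matrix ι ι ℤ} {t : ι → ℤ}

/-- Since `C` is nonsingular, the condition `q_{a,0} = 0` fixes the weights `∑_j j m_{b,j}`. -/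
theorem admissible_finite (h : IsSymmetrizedCartan C t) (ℓ : ι → ℕ) (n : ι × ℕ+ →₀ ℕ) :
    (admissible C ℓ n).Finite := by
  rcases (admissible C ℓ n).eq_empty_or_nonempty with hempty | ⟨m₀, hm₀⟩
  · rw [hempty]; exact Set.finite_empty
  refine (finite_sum_mul_le (fun y : ι × ℕ+ => (y.2 : ℕ)) (fun y => y.2.pos) (fun N => ?_)
    (m₀.sum fun y k => (y.2 : ℕ) * k)).subset fun m hm => ?_
  · refine (Set.finite_univ.prod (Set.finite_Iic (⟨N + 1, by omega⟩ : ℕ+))).subset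
      fun y (hy : (y.2 : ℕ) ≤ N) => ⟨Set.mem_univ _, ?_⟩
    exact show (y.2 : ℕ) ≤ N + 1 by omega
  · have hx := h.nonsing (fun b => wt (rowSum 1 b m) - wt (rowSum 1 b m₀)) fun a => by
      have h1 := hm a
      have h2 := hm₀ a
      rw [totalSpin_eq, wt_rowSum C] at h1 h2
      simp only [mul_sub, Finset.sum_sub_distrib]
      linarith
    have hsum : ∑ b, wt (rowSum 1 b m) = ∑ b, wt (rowSum 1 b m₀) :=
      Finset.sum_congr rfl fun b _ => sub_eq_zero.mp (congrFun hx b)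
    rw [sum_wt_rowSum_one, sum_wt_rowSum_one] at hsum
    exact (Nat.cast_injective hsum).le

/-- The summands with a negative vacancy number cancel. They are grouped by the largest level `k`
with a negative vacancy number, a colour `a` with `p_{a,k} < 0`, and all the multiplicities other
than those of colour `a` and level at most `k`. These do not affect the vacancy numbers of level at
least `k`, so they run freely in each group. -/
theorem sum_negative_vacancy_eq_zero (h : IsSymmetrizedCartan C t) (ℓ : ι → ℕ)
    (n : ι × ℕ+ →₀ ℕ) {s : Finset (ι × ℕ+ →₀ ℕ)}
    (hs : ∀ m, m ∈ s ↔ m ∈ admissible C ℓ n ∧ ∃ a i, vacancy C n m a i < 0) :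
    ∑ m ∈ s, summand C t n m = 0 := by
  classical
  rcases isEmpty_or_nonempty ι with hι | hι
  · refine Finset.sum_eq_zero fun m hm => ?_
    obtain ⟨a, -⟩ := ((hs m).mp hm).2
    exact isEmptyElim a
  let P (m : ι × ℕ+ →₀ ℕ) (k : ℕ+) : Prop := IsGreatest {i | ∃ a, vacancy C n m a i < 0} k
  let lev (m : ι × ℕ+ →₀ ℕ) : ℕ+ := Classical.epsilon (P m)
  let col (m : ι × ℕ+ →₀ ℕ) : ι := Classical.epsilon fun a => vacancy C n m a (lev m) < 0
  let F (m : ι × ℕ+ →₀ ℕ) : ℕ+ × ι × (ι × ℕ+ →₀ ℕ) :=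
    (lev m, col m, m.filter fun y => ¬ (y.1 = col m ∧ y.2 ≤ lev m))
  refine Finset.sum_cancels_of_partition_cancels (Setoid.ker F) fun m hm => ?_
  obtain ⟨hadm, a', i', hai'⟩ := (hs m).mp hm
  obtain ⟨K, hK⟩ := exists_vacancy_eq hadm
  have hbdd : ({i | ∃ a, vacancy C n m a i < 0} : Set ℕ+).Finite := by
    refine (Set.finite_Iic (⟨K + 1, by omega⟩ : ℕ+)).subset ?_
    rintro i ⟨a, ha⟩
    by_contra hi
    have : K + 1 < (i : ℕ) := not_le.mp hi
    have := hK a i ((Nat.le_succ K).trans this.le)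
    omega
  obtain ⟨k₀, hk₀⟩ : ∃ k, P m k := by
    obtain ⟨k, hk, hmax⟩ := hbdd.exists_maximalFor id _ ⟨i', a', hai'⟩
    exact ⟨k, hk, fun j hj => (le_total j k).elim id fun hkj => hmax hj hkj⟩
  have hPk : P m (lev m) := Classical.epsilon_spec ⟨k₀, hk₀⟩
  have hcol : vacancy C n m (col m) (lev m) < 0 :=
    Classical.epsilon_spec (p := fun a => vacancy C n m a (lev m) < 0) hPk.1
  set k := lev m with hk
  set a := col m with ha
  obtain ⟨x₀, hx₀, hmx⟩ := exists_add_colour m a k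
  set μ := m.filter fun y => ¬ (y.1 = a ∧ y.2 ≤ k) with hμdef
  have hμ : ∀ i ≤ k, μ (a, i) = 0 := fun i hi => by
    rw [hμdef, Finsupp.filter_apply_neg _ _ (by simp [hi])]
  set ω := wt (levels x₀) with hω
  have hspin (b : ι) : totalSpin C ℓ n μ b + C b a * ω = 0 := by
    rw [hω, ← totalSpin_add_colour, ← hmx]
    exact hadm b
  have hvac (x : ℕ+ →₀ ℕ) (hx : ∀ i, k < i → x i = 0) (hxω : wt (levels x) = ω) (b : ι) (i : ℕ+)
      (hi : k ≤ i) : vacancy C n (μ + colour a x) b i = vacancy C n m b i := by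
    conv_rhs => rw [hmx]
    rw [vacancy_add_colour, vacancy_add_colour, minSum_levels_eq_wt hx hi,
      minSum_levels_eq_wt hx₀ hi, hxω]
  have hF (x : ℕ+ →₀ ℕ) (hx : ∀ i, k < i → x i = 0) (hxω : wt (levels x) = ω) :
      F (μ + colour a x) = F m := by
    have hP : P (μ + colour a x) k := by
      refine ⟨⟨a, by rw [hvac x hx hxω a k le_rfl]; exact hcol⟩, ?_⟩
      rintro j ⟨b, hb⟩
      by_contra hj
      rw [hvac x hx hxω b j (not_le.mp hj).le] at hb
      exact hj (hPk.2 ⟨b, hb⟩)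
    have hl : lev (μ + colour a x) = k :=
      (Classical.epsilon_spec ⟨k, hP⟩ : P _ (lev (μ + colour a x))).unique hP
    have hc : col (μ + colour a x) = a := by
      simp only [col, hl]
      rw [ha]
      simp only [col]
      congr 1
      funext b
      rw [hvac x hx hxω b k le_rfl]
    simp only [F, hl, hc, ← hk, ← ha, ← hμdef]
    rw [filter_add_colour hμ hx]
  have hfin : {x : ℕ+ →₀ ℕ | 2 * wt (levels x) = 2 * ω ∧ ∀ i, k < i → x i = 0}.Finite :=
    (finite_setOf_two_mul_wt_eq (2 * ω)).subset fun x hx => hx.1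
  have himage : s.filter (fun m' => Setoid.ker F m' m)
      = hfin.toFinset.image fun x => μ + colour a x := by
    ext m'
    simp only [Finset.mem_filter, Finset.mem_image, Set.Finite.mem_toFinset, Setoid.ker_def]
    constructor
    · rintro ⟨hm', hFm⟩
      simp only [F, Prod.mk.injEq] at hFm
      obtain ⟨hl, hc, hf⟩ := hFm
      rw [hl, hc] at hf
      obtain ⟨x, hx, hm'x⟩ := exists_add_colour m' a k
      have hf' : m'.filter (fun y => ¬ (y.1 = a ∧ y.2 ≤ k)) = μ := hf
      rw [hf'] at hm'x
      refine ⟨x, ⟨?_, hx⟩, hm'x.symm⟩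
      have h1 := ((hs m').mp hm').1 a
      rw [hm'x, totalSpin_add_colour, h.diag] at h1
      have h2 := hspin a
      rw [h.diag] at h2
      linarith
    · rintro ⟨x, ⟨hxω, hx⟩, rfl⟩
      have hxω' : wt (levels x) = ω := by linarith
      refine ⟨(hs _).mpr ⟨fun b => ?_, a, k, ?_⟩, hF x hx hxω'⟩
      · rw [totalSpin_add_colour, hxω']
        exact hspin b
      · rw [hvac x hx hxω' a k le_rfl]
        exact hcol
  have hinj : Function.Injective fun x => μ + colour a x := fun x y hxy =>
    Finsupp.mapDomain_injective (Prod.mk_right_injective a) (add_left_cancel hxy)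
  have hvacμ (i : ℕ+) (hi : k ≤ i) :
      vacancy C n m a i = minSum i (rowSum 1 a n - rowSum C a μ) - 2 * ω := by
    conv_lhs => rw [hmx]
    rw [vacancy_add_colour, vacancy_eq, minSum_levels_eq_wt hx₀ hi, h.diag, map_sub]
  rw [himage, Finset.sum_image fun x _ y _ hxy => hinj hxy]
  refine sum_fibre_eq_zero h n μ a k hμ ω ?_ ?_ fun x => by
    rw [Set.Finite.mem_toFinset]; exact Iff.rfl
  · have := hvacμ k le_rfl
    omega
  · have h1 := hvacμ (k + 1) (PNat.lt_add_right k 1).le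
    have h2 : 0 ≤ vacancy C n m a (k + 1) := by
      by_contra hneg
      exact absurd (hPk.2 ⟨a, not_le.mp hneg⟩) (not_le.mpr (PNat.lt_add_right k 1))
    rw [PNat.add_coe, PNat.one_coe] at h1
    omega

theorem MSum_eq_MTildeSum (h : IsSymmetrizedCartan C t) (ℓ : ι → ℕ) (n : ι × ℕ+ →₀ ℕ) :
    MSum C t ℓ n = MTildeSum C t ℓ n := by
  classical
  have hfin := admissible_finite h ℓ n
  have hfin' : {m ∈ admissible C ℓ n | ∀ (a : ι) (i : ℕ+), 0 ≤ vacancy C n m a i}.Finite :=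
    hfin.subset fun m hm => hm.1
  rw [MSum, MTildeSum, finsum_mem_eq_finite_toFinset_sum _ hfin,
    finsum_mem_eq_finite_toFinset_sum _ hfin',
    ← Finset.sum_filter_add_sum_filter_not hfin.toFinset
      (fun m => ∀ (a : ι) (i : ℕ+), 0 ≤ vacancy C n m a i),
    sum_negative_vacancy_eq_zero h ℓ n (s := hfin.toFinset.filter
      fun m => ¬ ∀ (a : ι) (i : ℕ+), 0 ≤ vacancy C n m a i) fun m => by simp, add_zero]
  refine Finset.sum_congr ?_ fun _ _ => rfl
  ext m
  simp

end Global

/-! ### The Cartan matrices -/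

theorem sum_fin_ite_val_eq {r : ℕ} (k : ℕ) (g : Fin r → ℤ) :
    (∑ b : Fin r, if (b : ℕ) = k then g b else 0) = if h : k < r then g ⟨k, h⟩ else 0 := by
  split_ifs with h
  · rw [Finset.sum_eq_single ⟨k, h⟩]
    · simp
    · intro b _ hb
      exact if_neg fun hbk => hb (Fin.ext hbk)
    · simp
  · exact Finset.sum_eq_zero fun b _ => if_neg (by omega)

/-- The rows other than the last force a kernel vector of the Cartan matrix of type `C_r` to be
`x_i = (i + 1) x_0`, and then the last row forces `x_0 = 0`. -/
theorem cartanC_nonsing {r : ℕ} (hr : 2 ≤ r) (x : Fin r → ℤ)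
    (hx : ∀ a, ∑ b, (CartanMatrix.C r) a b * x b = 0) : x = 0 := by
  set f : ℕ → ℤ := fun i => if h : i < r then x ⟨i, h⟩ else 0 with hf
  have hrow (i : ℕ) (hi : i < r) : 2 * f i - f (i + 1)
      - (if i = 0 then 0 else (if i = r - 1 then 2 else 1) * f (i - 1)) = 0 := by
    refine Eq.trans ?_ (hx ⟨i, hi⟩)
    have hterm (b : Fin r) : (CartanMatrix.C r) ⟨i, hi⟩ b * x b =
        (if (b : ℕ) = i then 2 * x b else 0) + (if (b : ℕ) = i + 1 then -x b else 0)
          + (if i = 0 then 0 else if (b : ℕ) = i - 1 then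
              -((if i = r - 1 then 2 else 1) * x b) else 0) := by
      simp only [CartanMatrix.C, Matrix.of_apply, Fin.ext_iff]
      split_ifs <;> omega
    simp only [hterm, Finset.sum_add_distrib, sum_fin_ite_val_eq, hf]
    rcases Nat.eq_zero_or_pos i with rfl | hpos
    · simp [hi]
      split_ifs <;> ring
    · simp only [hpos.ne', if_false, sum_fin_ite_val_eq, hi, show i - 1 < r by omega, dif_pos]
      split_ifs <;> ring
  have hlin (i : ℕ) (hi : i < r) : f i = (i + 1) * f 0 := by
    induction i using Nat.strong_induction_on with
    | _ i ih =>
      rcases i with _ | _ | i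
      · simp
      · have := hrow 0 (by omega)
        simp at this
        push_cast
        linarith
      · have h1 := hrow (i + 1) (by omega)
        rw [if_neg (by omega), if_neg (by omega), ih (i + 1) (by omega) (by omega),
          Nat.add_sub_cancel, ih i (by omega) (by omega)] at h1
        push_cast at h1 ⊢
        linarith
  obtain ⟨s, rfl⟩ : ∃ s, r = s + 2 := ⟨r - 2, by omega⟩
  have hend := hrow (s + 1) (by omega)
  have hout : f (s + 1 + 1) = 0 := by simp [hf]
  rw [if_neg (by omega), if_pos (by omega), hout, hlin (s + 1) (by omega), Nat.add_sub_cancel,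
    hlin s (by omega)] at hend
  push_cast at hend
  have h0 : f 0 = 0 := by linarith
  ext ⟨i, hi⟩
  have := hlin i hi
  rw [h0, mul_zero] at this
  simpa [hf, hi] using this

theorem cartanC_det_ne_zero {r : ℕ} (hr : 2 ≤ r) : (CartanMatrix.C r).det ≠ 0 := by
  intro h
  obtain ⟨x, hx0, hx⟩ := Matrix.exists_mulVec_eq_zero_iff.mpr h
  exact hx0 (cartanC_nonsing hr x fun a => congrFun hx a)

theorem cartan_det_ne_zero (X : TwistedType) : X.cartan.det ≠ 0 := by
  cases X with
  | A2 r hr =>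
    change (CartanMatrix.C r).transpose.det ≠ 0
    rw [Matrix.det_transpose]
    exact cartanC_det_ne_zero hr
  | D2 r hr =>
    change (CartanMatrix.B r).transpose.det ≠ 0
    rw [CartanMatrix.B_transpose]
    exact cartanC_det_ne_zero hr
  | E62 =>
    change CartanMatrix.F₄.det ≠ 0
    rw [CartanMatrix.F₄_det]
    exact one_ne_zero
  | D43 =>
    change CartanMatrix.G₂.det ≠ 0
    rw [CartanMatrix.G₂_det]
    exact one_ne_zero

theorem cartan_diag (X : TwistedType) (a : Fin X.rank) : X.cartan a a = 2 := by
  cases X with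
  | A2 r hr => exact CartanMatrix.C_diag r a
  | D2 r hr => exact CartanMatrix.B_diag r a
  | E62 => exact CartanMatrix.F₄_diag a
  | D43 => exact CartanMatrix.G₂_diag a

theorem cartan_offDiag_nonpos (X : TwistedType) (a b : Fin X.rank) (h : a ≠ b) :
    X.cartan a b ≤ 0 := by
  cases X with
  | A2 r hr => exact CartanMatrix.C_off_diag_nonpos r b a h.symm
  | D2 r hr => exact CartanMatrix.B_off_diag_nonpos r b a h.symm
  | E62 => exact CartanMatrix.F₄_off_diag_nonpos a b h
  | D43 => exact CartanMatrix.G₂_off_diag_nonpos a b h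

theorem isSymmetrizedCartan_cartan (X : TwistedType) {t : Fin X.rank → ℤ}
    (ht_min : IsLeast (Set.range t) 1)
    (ht_symm : ∀ a b, t a * X.cartan a b = t b * X.cartan b a) :
    IsSymmetrizedCartan X.cartan t where
  diag := cartan_diag X
  offDiag := cartan_offDiag_nonpos X
  pos a := ht_min.2 ⟨a, rfl⟩
  symm := ht_symm
  nonsing x hx := by
    by_contra hx0
    exact cartan_det_ne_zero X (Matrix.exists_mulVec_eq_zero_iff.mp ⟨x, hx0, funext hx⟩)

end Fermionic

theorem theorem1p1 (X : TwistedType) (t : Fin X.rank → ℤ)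
    (ht_min : IsLeast (Set.range t) 1)
    (ht_symm : ∀ a b, t a * X.cartan a b = t b * X.cartan b a)
    (ℓ : Fin X.rank → ℕ) (n : Fin X.rank × ℕ+ →₀ ℕ) :
    (Fermionic.admissible X.cartan ℓ n).Finite ∧
      Fermionic.MSum X.cartan t ℓ n = Fermionic.MTildeSum X.cartan t ℓ n :=
  have h := Fermionic.isSymmetrizedCartan_cartan X ht_min ht_symm
  ⟨Fermionic.admissible_finite h ℓ n, Fermionic.MSum_eq_MTildeSum h ℓ n⟩
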